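/- Assume the Riemann hypothesis and fix a real number $\delta>0$. Then, as $T\to\infty$ (with implied constants that may depend on $\delta$), $$\int_T^{T+\delta}|\zeta(1+it)|\,dt=O(\log\log\log T)\qquad\text{and}\qquad \int_T^{T+\delta}|\zeta(1+it)|^{-1}\,dt=O(\log\log\log T),$$ where $\zeta$ is the Riemann zeta-function. -/

import Mathlib

open Filter Asymptotics

/-! The proof moves the problem slightly into the region of absolute convergence and there compares
height `T` with height `0`.

Under RH, `ζ'/ζ = O(log log T)` on `re s ≥ 1` near height `T`
(`RiemannHypothesis.exists_norm_logDeriv_le_log_log`). This is a three-circle estimate: the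
Dirichlet series gives `2 log log T` on the inner circle, RH with Borel–Carathéodory gives a power
of `log T` on the outer one, and that power enters with exponent `O(1 / log log T)`, so it costs
only a constant. Integrating over a segment of length `η = 1 / log log T` shows that `|ζ|` on the
line `1` and on the line `1 + η` agree up to a constant factor.

On the line `1 + η` a majorant principle applies (`gaussMajorized_norm_riemannZeta`). There `log
|ζ|` is a cosine series with nonnegative coefficients; inverting `ζ` only flips signs and
translating by `T` only adds unimodular phases. As the Gaussian has a positive Fourier transform,
the Gaussian mean of `|ζ|` or `|ζ|⁻¹` around `T` is at most that of `|ζ|` around `0`. The latter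
sees the pole as `1 / |η + it|`, hence is `O(log (1 / η)) = O(log log log T)`. -/

/-! ### Growth of `ζ` to the right of the critical line -/

/-- The error `(1 - s) n⁻ˢ - ∫ (1 - s) x⁻ˢ` on `[n, n + 1]` (shifted by one) in comparing the zeta
series with an integral. -/
noncomputable def zetaIntegralError (n : ℕ) (s : ℂ) : ℂ :=
  (1 - s) * ((n : ℂ) + 1) ^ (-s) - (((n : ℂ) + 2) ^ (1 - s) - ((n : ℂ) + 1) ^ (1 - s))

lemma norm_cpow_sub_cpow_le {a x : ℝ} (ha : 0 < a) (hx : x ∈ Set.Icc a (a + 1)) {s : ℂ}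
    (hs : 0 ≤ s.re) : ‖(x : ℂ) ^ (-s) - (a : ℂ) ^ (-s)‖ ≤ ‖s‖ * a ^ (-s.re - 1) := by
  have hd : ∀ y ∈ Set.Icc a (a + 1), HasDerivWithinAt (fun y : ℝ => (y : ℂ) ^ (-s))
      (-s * (y : ℂ) ^ (-s - 1)) (Set.Icc a (a + 1)) y := by
    intro y hy
    have hy0 : 0 < y := ha.trans_le hy.1
    have h := (hasDerivAt_id (y : ℂ)).cpow_const (c := -s) (Or.inl (by simpa using hy0))
    simpa using h.comp_ofReal.hasDerivWithinAt
  have hb : ∀ y ∈ Set.Icc a (a + 1), ‖-s * (y : ℂ) ^ (-s - 1)‖ ≤ ‖s‖ * a ^ (-s.re - 1) := by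
    intro y hy
    have hy0 : 0 < y := ha.trans_le hy.1
    rw [norm_mul, norm_neg, Complex.norm_cpow_eq_rpow_re_of_pos hy0]
    gcongr ‖s‖ * ?_
    simpa using Real.rpow_le_rpow_of_nonpos ha hy.1 (by linarith : -s.re - 1 ≤ 0)
  have := (convex_Icc a (a + 1)).norm_image_sub_le_of_norm_hasDerivWithin_le hd hb
    (Set.left_mem_Icc.2 (by linarith)) hx
  refine this.trans ?_
  have h1 : ‖x - a‖ ≤ 1 := by
    rw [Real.norm_eq_abs, abs_le]; constructor <;> linarith [hx.1, hx.2]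
  exact mul_le_of_le_one_right (by positivity) h1

/-- The error is the increment over `[a, a + 1]` of `(1 - s) a⁻ˢ y - y¹⁻ˢ`, whose derivative is a
difference of powers. This gains one power of `a`, so the errors are summable for `re s > 0`. -/
lemma norm_zetaIntegralError_le (n : ℕ) {s : ℂ} (hs : 0 ≤ s.re) :
    ‖zetaIntegralError n s‖ ≤ ‖s - 1‖ * ‖s‖ * ((n : ℝ) + 1) ^ (-s.re - 1) := by
  set a : ℝ := (n : ℝ) + 1
  have ha : 0 < a := by positivity
  have hd : ∀ y ∈ Set.Icc a (a + 1), HasDerivWithinAt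
      (fun y : ℝ => (1 - s) * (a : ℂ) ^ (-s) * (y : ℂ) - (y : ℂ) ^ (1 - s))
      ((1 - s) * (a : ℂ) ^ (-s) - (1 - s) * (y : ℂ) ^ (-s)) (Set.Icc a (a + 1)) y := by
    intro y hy
    have hy0 : 0 < y := ha.trans_le hy.1
    have h := (hasDerivAt_id (y : ℂ)).cpow_const (c := 1 - s) (Or.inl (by simpa using hy0))
    have h2 := ((hasDerivAt_id (y : ℂ)).const_mul ((1 - s) * (a : ℂ) ^ (-s))).sub h
    simpa using h2.comp_ofReal.hasDerivWithinAt
  have hb : ∀ y ∈ Set.Icc a (a + 1), ‖(1 - s) * (a : ℂ) ^ (-s) - (1 - s) * (y : ℂ) ^ (-s)‖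
      ≤ ‖s - 1‖ * ‖s‖ * a ^ (-s.re - 1) := by
    intro y hy
    rw [← mul_sub, norm_mul, norm_sub_rev 1 s, mul_assoc]
    gcongr
    rw [norm_sub_rev]
    exact norm_cpow_sub_cpow_le ha hy hs
  have := (convex_Icc a (a + 1)).norm_image_sub_le_of_norm_hasDerivWithin_le hd hb
    (Set.left_mem_Icc.2 (by linarith)) (Set.right_mem_Icc.2 (by linarith))
  refine le_trans (le_of_eq ?_) (this.trans (le_of_eq ?_))
  · congr 1
    simp only [zetaIntegralError, a]
    push_cast
    ring_nf
  · simp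

lemma differentiable_zetaIntegralError (n : ℕ) : Differentiable ℂ (zetaIntegralError n) := by
  have h1 : (n : ℂ) + 1 ≠ 0 := by exact_mod_cast Nat.succ_ne_zero n
  have h2 : (n : ℂ) + 2 ≠ 0 := by exact_mod_cast Nat.succ_ne_zero (n + 1)
  intro s
  unfold zetaIntegralError
  have e1 : DifferentiableAt ℂ (fun s : ℂ => ((n : ℂ) + 1) ^ (-s)) s :=
    DifferentiableAt.const_cpow (by fun_prop) (Or.inl h1)
  have e2 : DifferentiableAt ℂ (fun s : ℂ => ((n : ℂ) + 1) ^ (1 - s)) s :=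
    DifferentiableAt.const_cpow (by fun_prop) (Or.inl h1)
  have e3 : DifferentiableAt ℂ (fun s : ℂ => ((n : ℂ) + 2) ^ (1 - s)) s :=
    DifferentiableAt.const_cpow (by fun_prop) (Or.inl h2)
  fun_prop

lemma summable_succ_rpow_neg {p : ℝ} (hp : p < -1) :
    Summable fun n : ℕ => ((n : ℝ) + 1) ^ p := by
  have := (summable_nat_add_iff 1).2 (Real.summable_nat_rpow.2 hp)
  simpa using this

lemma hasSum_zetaIntegralError {s : ℂ} (hs : 1 < s.re) :
    HasSum (fun n => zetaIntegralError n s) (1 - (s - 1) * riemannZeta s) := by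
  have hz : HasSum (fun n : ℕ => ((n : ℂ) + 1) ^ (-s)) (riemannZeta s) := by
    rw [zeta_eq_tsum_one_div_nat_add_one_cpow hs]
    have : Summable fun n : ℕ => 1 / ((n : ℂ) + 1) ^ s := by
      have := (summable_nat_add_iff 1).2 (Complex.summable_one_div_nat_cpow.2 hs)
      simpa using this
    simpa [Complex.cpow_neg] using this.hasSum
  have hs1 : Summable fun n => zetaIntegralError n s := by
    refine Summable.of_norm_bounded ((summable_succ_rpow_neg (p := -s.re - 1) (by linarith)).mul_left
      (‖s - 1‖ * ‖s‖)) fun n => norm_zetaIntegralError_le n (by linarith)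
  have ht : Tendsto (fun N : ℕ => ((N : ℂ) + 1) ^ (1 - s)) atTop (nhds 0) := by
    rw [tendsto_zero_iff_norm_tendsto_zero]
    have h1 : Tendsto (fun N : ℕ => ((N : ℝ) + 1)) atTop atTop :=
      tendsto_atTop_add_const_right _ _ tendsto_natCast_atTop_atTop
    have h2 := (tendsto_rpow_neg_atTop (y := s.re - 1) (by linarith)).comp h1
    refine h2.congr fun N => ?_
    have := Complex.norm_cpow_eq_rpow_re_of_pos (x := (N : ℝ) + 1) (by positivity) (1 - s)
    push_cast at this
    rw [this]
    simp
  have hpart : Tendsto (fun N : ℕ => ∑ n ∈ Finset.range N, zetaIntegralError n s) atTop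
      (nhds ((1 - s) * riemannZeta s - (0 - 1))) := by
    have h := ((hz.tendsto_sum_nat).const_mul (1 - s)).sub (ht.sub_const 1)
    refine h.congr fun N => ?_
    simp only [zetaIntegralError]
    rw [Finset.sum_sub_distrib, Finset.mul_sum]
    congr 1
    have := Finset.sum_range_sub (fun n : ℕ => ((n : ℂ) + 1) ^ (1 - s)) N
    simp only [Nat.cast_zero, zero_add, Complex.one_cpow] at this
    rw [← this]
    refine Finset.sum_congr rfl fun n _ => ?_
    push_cast
    ring_nf
  have := tendsto_nhds_unique hs1.hasSum.tendsto_sum_nat hpart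
  rw [show 1 - (s - 1) * riemannZeta s = (1 - s) * riemannZeta s - (0 - 1) by ring, ← this]
  exact hs1.hasSum

lemma differentiableOn_tsum_zetaIntegralError :
    DifferentiableOn ℂ (fun s => ∑' n, zetaIntegralError n s) {s | 1 / 4 < s.re} := by
  have hopen : IsOpen {s : ℂ | 1 / 4 < s.re} := isOpen_lt continuous_const Complex.continuous_re
  intro s hs
  -- The factor `‖s - 1‖ * ‖s‖` in the error bound is only locally bounded, hence the ball.
  set U : Set ℂ := {s : ℂ | 1 / 4 < s.re} ∩ Metric.ball 0 (‖s‖ + 1)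
  have hU : IsOpen U := hopen.inter Metric.isOpen_ball
  have hsU : s ∈ U := ⟨hs, by simp⟩
  have hd : DifferentiableOn ℂ (fun s => ∑' n, zetaIntegralError n s) U := by
    refine Complex.differentiableOn_tsum_of_summable_norm
      (u := fun n : ℕ => (‖s‖ + 2) * (‖s‖ + 1) * ((n : ℝ) + 1) ^ (-(5 / 4) : ℝ))
      ((summable_succ_rpow_neg (by norm_num)).mul_left _)
      (fun n => (differentiable_zetaIntegralError n).differentiableOn) hU ?_
    intro n w hw
    have hw1 : 1 / 4 < w.re := hw.1
    have hw2 : ‖w‖ ≤ ‖s‖ + 1 := by simpa using (Metric.mem_ball.1 hw.2).le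
    refine (norm_zetaIntegralError_le n (by linarith)).trans ?_
    gcongr
    · calc ‖w - 1‖ ≤ ‖w‖ + ‖(1 : ℂ)‖ := norm_sub_le _ _
        _ ≤ ‖s‖ + 2 := by simp; linarith
    · linarith [(Nat.cast_nonneg n : (0 : ℝ) ≤ n)]
    · linarith
  exact (hd.differentiableAt (hU.mem_nhds hsU)).differentiableWithinAt

/-- Analytic continuation from `re s > 1`. Working with the entire function `riemannZeta₁` avoids
puncturing the half-plane at `1`. -/
lemma sub_one_mul_riemannZeta_eq {s : ℂ} (hs : 1 / 4 < s.re) (h1 : s ≠ 1) :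
    (s - 1) * riemannZeta s = 1 - ∑' n, zetaIntegralError n s := by
  have hopen : IsOpen {s : ℂ | 1 / 4 < s.re} := isOpen_lt continuous_const Complex.continuous_re
  have hconv : Convex ℝ {s : ℂ | 1 / 4 < s.re} := convex_halfSpace_re_gt _
  have hA : AnalyticOnNhd ℂ riemannZeta₁ {s : ℂ | 1 / 4 < s.re} :=
    differentiable_riemannZeta₁.differentiableOn.analyticOnNhd hopen
  have hB : AnalyticOnNhd ℂ (fun s => 1 - ∑' n, zetaIntegralError n s) {s : ℂ | 1 / 4 < s.re} :=
    ((differentiableOn_const 1).sub differentiableOn_tsum_zetaIntegralError).analyticOnNhd hopen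
  have hne : ∀ {w : ℂ}, w ≠ 1 → riemannZeta₁ w = (w - 1) * riemannZeta w := by
    intro w hw
    rw [riemannZeta_eq_inv_sub_mul hw, mul_inv_cancel_left₀ (sub_ne_zero.2 hw)]
  have heq := hA.eqOn_of_preconnected_of_eventuallyEq hB hconv.isPreconnected
    (z₀ := 2) (by norm_num) ?_
  · rw [← hne h1]; exact heq hs
  · have : {s : ℂ | 1 < s.re} ∈ nhds (2 : ℂ) :=
      (isOpen_lt continuous_const Complex.continuous_re).mem_nhds (by norm_num)
    filter_upwards [this] with w hw
    have hw' : w ≠ 1 := by rintro rfl; simp at hw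
    rw [hne hw', (hasSum_zetaIntegralError hw).tsum_eq]
    ring

/-- Serves twice: as polynomial growth high up, and as a description of the pole at `1` with the
sharp coefficient of `1 / ‖s - 1‖`. -/
theorem exists_norm_riemannZeta_le : ∃ C : ℝ, 0 < C ∧ ∀ s : ℂ, 1 / 2 ≤ s.re → s ≠ 1 →
    ‖riemannZeta s‖ ≤ 1 / ‖s - 1‖ + C * ‖s‖ := by
  have hsum := summable_succ_rpow_neg (p := -(3 / 2)) (by norm_num)
  refine ⟨∑' n : ℕ, ((n : ℝ) + 1) ^ (-(3 / 2) : ℝ),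
    hsum.tsum_pos (fun n => by positivity) 0 (by simp), fun s hs h1 => ?_⟩
  have hp : 0 < ‖s - 1‖ := norm_pos_iff.2 (sub_ne_zero.2 h1)
  have key : ‖∑' n, zetaIntegralError n s‖ ≤ ‖s - 1‖ * ‖s‖ *
      ∑' n : ℕ, ((n : ℝ) + 1) ^ (-(3 / 2) : ℝ) := by
    rw [← tsum_mul_left]
    refine tsum_of_norm_bounded (hsum.mul_left _).hasSum fun n => ?_
    refine (norm_zetaIntegralError_le n (by linarith)).trans ?_
    gcongr
    · linarith [(Nat.cast_nonneg n : (0 : ℝ) ≤ n)]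
    · linarith
  have h2 : ‖s - 1‖ * ‖riemannZeta s‖ ≤ 1 + ‖∑' n, zetaIntegralError n s‖ := by
    rw [← norm_mul, sub_one_mul_riemannZeta_eq (by linarith) h1]
    exact (norm_sub_le _ _).trans (by simp)
  rw [← mul_le_mul_iff_right₀ hp, mul_add, mul_one_div_cancel hp.ne']
  nlinarith

/-! ### Tools from complex analysis -/

/-- **Hadamard three-circle theorem**. -/
theorem norm_le_interp_of_three_circles {f : ℂ → ℂ} {c z : ℂ} {R r₁ r₂ a b : ℝ} (h₁ : 0 < r₁)
    (h₁₂ : r₁ < r₂) (h₂ : r₂ < R) (hf : DifferentiableOn ℂ f (Metric.ball c R))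
    (ha : ∀ w, ‖w - c‖ = r₁ → ‖f w‖ ≤ a) (hb : ∀ w, ‖w - c‖ = r₂ → ‖f w‖ ≤ b)
    (hz₁ : r₁ ≤ ‖z - c‖) (hz₂ : ‖z - c‖ ≤ r₂) :
    ‖f z‖ ≤ a ^ (1 - Real.log (‖z - c‖ / r₁) / Real.log (r₂ / r₁)) *
      b ^ (Real.log (‖z - c‖ / r₁) / Real.log (r₂ / r₁)) := by
  have h2 : 0 < r₂ := h₁.trans h₁₂
  have hR : 0 < R := h2.trans h₂
  have hzc : 0 < ‖z - c‖ := h₁.trans_le hz₁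
  have hz0 : z - c ≠ 0 := norm_pos_iff.1 hzc
  have hlog : Real.log r₁ < Real.log r₂ := Real.log_lt_log h₁ h₁₂
  -- The exponential maps a vertical strip onto the annulus, reducing to the three-lines theorem.
  set g : ℂ → ℂ := fun w => f (c + Complex.exp w)
  have hmem : ∀ w : ℂ, w.re ≤ Real.log r₂ → c + Complex.exp w ∈ Metric.closedBall c r₂ := by
    intro w hw
    simp only [Metric.mem_closedBall, dist_self_add_left, Complex.norm_exp]
    exact (Real.le_log_iff_exp_le h2).1 hw
  have hcl : closure (Complex.HadamardThreeLines.verticalStrip (Real.log r₁) (Real.log r₂)) ⊆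
      {w : ℂ | w.re ≤ Real.log r₂} :=
    closure_minimal (fun w hw => hw.2.le) (isClosed_le Complex.continuous_re continuous_const)
  have hd : DiffContOnCl ℂ g
      (Complex.HadamardThreeLines.verticalStrip (Real.log r₁) (Real.log r₂)) := by
    refine DifferentiableOn.diffContOnCl fun w hw => ?_
    have hw' : c + Complex.exp w ∈ Metric.ball c R :=
      Metric.closedBall_subset_ball h₂ (hmem w (hcl hw))
    have hfw := hf.differentiableAt (Metric.isOpen_ball.mem_nhds hw')
    exact (hfw.comp w (f := fun w => c + Complex.exp w) (by fun_prop)).differentiableWithinAt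
  have hB : BddAbove ((norm ∘ g) ''
      Complex.HadamardThreeLines.verticalClosedStrip (Real.log r₁) (Real.log r₂)) := by
    obtain ⟨C, hC⟩ := (isCompact_closedBall c r₂).exists_bound_of_continuousOn
      (hf.continuousOn.mono (Metric.closedBall_subset_ball h₂))
    refine ⟨C, ?_⟩
    rintro _ ⟨w, hw, rfl⟩
    exact hC _ (hmem w hw.2)
  have key := Complex.HadamardThreeLines.norm_le_interp_of_mem_verticalClosedStrip' (f := g)
    (z := Complex.log (z - c)) (a := a) (b := b) hlog ?_ hd hB ?_ ?_
  · simp only [g, Complex.exp_log hz0, Complex.log_re, add_sub_cancel] at key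
    rwa [← Real.log_div hzc.ne' h₁.ne', ← Real.log_div h2.ne' h₁.ne'] at key
  · simp only [Complex.HadamardThreeLines.verticalClosedStrip, Set.mem_preimage, Complex.log_re,
      Set.mem_Icc]
    exact ⟨Real.log_le_log h₁ hz₁, Real.log_le_log hzc hz₂⟩
  · intro w hw
    refine ha _ ?_
    simp only [Set.mem_preimage, Set.mem_singleton_iff] at hw
    simp [Complex.norm_exp, hw, Real.exp_log h₁]
  · intro w hw
    refine hb _ ?_
    simp only [Set.mem_preimage, Set.mem_singleton_iff] at hw
    simp [Complex.norm_exp, hw, Real.exp_log h2]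

/-- A nonvanishing holomorphic function on a disc has a holomorphic logarithm. -/
theorem exists_log_of_ne_zero_on_ball {f : ℂ → ℂ} {c : ℂ} {R : ℝ} (hR : 0 < R)
    (hf : DifferentiableOn ℂ f (Metric.ball c R)) (h0 : ∀ z ∈ Metric.ball c R, f z ≠ 0) :
    ∃ g : ℂ → ℂ, g c = 0 ∧ (∀ z ∈ Metric.ball c R, HasDerivAt g (deriv f z / f z) z) ∧
      ∀ z ∈ Metric.ball c R, f z = f c * Complex.exp (g z) := by
  have hc : c ∈ Metric.ball c R := Metric.mem_ball_self hR
  obtain ⟨g, hgc, hg⟩ := ((hf.deriv Metric.isOpen_ball).div hf h0).isExactOn_ball.with_val_at c 0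
  refine ⟨g, hgc, hg, fun z hz => ?_⟩
  have hder : ∀ w ∈ Metric.ball c R,
      HasDerivAt (fun w => f w * Complex.exp (-g w)) 0 w := by
    intro w hw
    have h1 := (hf.differentiableAt (Metric.isOpen_ball.mem_nhds hw)).hasDerivAt
    refine (h1.mul (hg w hw).neg.cexp).congr_deriv ?_
    have := h0 w hw
    simp only [Pi.div_apply]
    field_simp
    ring
  have hconst := (convex_ball c R).is_const_of_fderivWithin_eq_zero (𝕜 := ℂ)
    (f := fun w => f w * Complex.exp (-g w))
    (fun w hw => (hder w hw).differentiableAt.differentiableWithinAt)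
    (fun w hw => by
      rw [fderivWithin_of_isOpen Metric.isOpen_ball hw]
      ext
      simp [(hder w hw).hasFDerivAt.fderiv]) hz hc
  simp only [hgc, neg_zero, Complex.exp_zero, mul_one] at hconst
  rw [← hconst, mul_assoc, ← Complex.exp_add]
  simp

/-- A bound for the logarithmic derivative of a nonvanishing holomorphic function in terms of its
growth on a disc. -/
theorem norm_logDeriv_le_of_norm_le_exp {f : ℂ → ℂ} {c z : ℂ} {R ρ M : ℝ} (hρ : 0 < ρ)
    (hR : ρ < R) (hM : 0 < M) (hf : DifferentiableOn ℂ f (Metric.ball c R))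
    (h0 : ∀ z ∈ Metric.ball c R, f z ≠ 0)
    (hfM : ∀ z ∈ Metric.ball c R, ‖f z‖ ≤ ‖f c‖ * Real.exp M) (hz : ‖z - c‖ ≤ ρ) :
    ‖deriv f z / f z‖ ≤ 8 * R / (R - ρ) ^ 2 * M := by
  have hR0 : 0 < R := hρ.trans hR
  have hc : c ∈ Metric.ball c R := Metric.mem_ball_self hR0
  obtain ⟨g, hgc, hg, hfg⟩ := exists_log_of_ne_zero_on_ball hR0 hf h0
  -- Half of the gap is spent on Borel–Carathéodory out to radius `ρ + d`, the other half leaves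
  -- room for Cauchy's estimate on a circle of radius `d` about `z`.
  set d := (R - ρ) / 2
  have hd : 0 < d := by simp only [d]; linarith
  have hgd : DifferentiableOn ℂ g (Metric.ball c R) :=
    fun w hw => (hg w hw).differentiableAt.differentiableWithinAt
  have hre : ∀ w ∈ Metric.ball c R, (g w).re ≤ M := by
    intro w hw
    have h := hfM w hw
    rw [hfg w hw, norm_mul, Complex.norm_exp] at h
    exact Real.exp_le_exp.1 (le_of_mul_le_mul_left h (norm_pos_iff.2 (h0 c hc)))
  have hbc : ∀ w, ‖w - c‖ ≤ ρ + d → ‖g w‖ ≤ 2 * M * R / d := by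
    intro w hw
    have hlt : ‖w - c‖ < R := by simp only [d] at hw; linarith
    have := Complex.borelCaratheodory_zero (f := fun u => g (c + u)) (R := R) (z := w - c) hM ?_ ?_
      hR0 (by simpa using hlt) (by simpa using hgc)
    · simp only [add_sub_cancel] at this
      refine this.trans ?_
      gcongr
      simp only [d] at hw ⊢
      linarith
    · refine hgd.comp (by fun_prop) fun u hu => ?_
      simpa using hu
    · intro u hu
      exact hre _ (by simpa using hu)
  have hball : Metric.closedBall z d ⊆ Metric.ball c R := by
    intro w hw
    rw [Metric.mem_ball, dist_eq_norm]
    have : ‖w - z‖ ≤ d := by simpa [dist_eq_norm] using hw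
    calc ‖w - c‖ ≤ ‖w - z‖ + ‖z - c‖ := norm_sub_le_norm_sub_add_norm_sub _ _ _
      _ < R := by simp only [d] at this; linarith
  have hcauchy := Complex.norm_deriv_le_of_forall_mem_sphere_norm_le (f := g) (c := z)
    (C := 2 * M * R / d) hd (hgd.mono hball |>.diffContOnCl_ball subset_rfl) fun w hw => by
      refine hbc w ?_
      have : ‖w - z‖ = d := by simpa [dist_eq_norm] using hw
      calc ‖w - c‖ ≤ ‖w - z‖ + ‖z - c‖ := norm_sub_le_norm_sub_add_norm_sub _ _ _
        _ ≤ ρ + d := by linarith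
  rw [(hg z (hball (Metric.mem_closedBall_self hd.le))).deriv] at hcauchy
  refine hcauchy.trans (le_of_eq ?_)
  have : R - ρ ≠ 0 := by linarith
  simp only [d]
  field_simp
  ring

/-! ### Estimates in the region of absolute convergence -/

/-- The Dirichlet coefficients of `-ζ'/ζ` are the nonnegative values of the von Mangoldt function.
-/
lemma norm_logDeriv_riemannZeta_le {s : ℂ} {σ : ℝ} (hσ : 1 < σ) (hs : σ ≤ s.re) :
    ‖deriv riemannZeta s / riemannZeta s‖ ≤ ‖deriv riemannZeta σ / riemannZeta σ‖ := by
  have key : ∀ {w : ℂ}, 1 < w.re → deriv riemannZeta w / riemannZeta w =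
      -LSeries (fun n => (ArithmeticFunction.vonMangoldt n : ℂ)) w := by
    intro w hw
    rw [ArithmeticFunction.LSeries_vonMangoldt_eq_deriv_riemannZeta_div hw]
    ring
  have hσ' : 1 < (σ : ℂ).re := by simpa using hσ
  have hsum := ArithmeticFunction.LSeriesSummable_vonMangoldt hσ'
  have hterm : ∀ n, LSeries.term (fun n => (ArithmeticFunction.vonMangoldt n : ℂ)) (σ : ℂ) n =
      (‖LSeries.term (fun n => (ArithmeticFunction.vonMangoldt n : ℂ)) (σ : ℂ) n‖ : ℝ) := by
    intro n
    rcases eq_or_ne n 0 with rfl | hn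
    · simp
    · rw [LSeries.norm_term_eq, LSeries.term_of_ne_zero hn, if_neg hn, Complex.norm_real,
        Real.norm_of_nonneg ArithmeticFunction.vonMangoldt_nonneg]
      push_cast
      rw [Complex.ofReal_cpow (Nat.cast_nonneg n)]
      simp
  rw [key (hσ.trans_le hs), key hσ', norm_neg, norm_neg]
  have h2 : LSeries (fun n => (ArithmeticFunction.vonMangoldt n : ℂ)) (σ : ℂ) =
      ((∑' n, ‖LSeries.term (fun n => (ArithmeticFunction.vonMangoldt n : ℂ)) (σ : ℂ) n‖ : ℝ) :
        ℂ) := by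
    rw [LSeries, Complex.ofReal_tsum]
    exact tsum_congr hterm
  rw [h2, Complex.norm_real, Real.norm_of_nonneg (tsum_nonneg fun n => norm_nonneg _)]
  refine tsum_of_norm_bounded hsum.norm.hasSum fun n => ?_
  exact LSeries.norm_term_le_of_re_le_re _ (by simpa using hs) n

/-- The simple pole gives `ζ'/ζ (1 + η) = -1 / η + O(1)`; doubling `1 / η` absorbs the bounded term.
-/
lemma exists_norm_logDeriv_riemannZeta_le :
    ∃ η₀ : ℝ, 0 < η₀ ∧ ∀ η : ℝ, 0 < η → η < η₀ → ∀ s : ℂ, 1 + η ≤ s.re →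
      ‖deriv riemannZeta s / riemannZeta s‖ ≤ 2 / η := by
  obtain ⟨C, hC⟩ := log_deriv_riemannZeta_add_inv_sub_bounded.bound
  obtain ⟨ε, hε, hb⟩ := Metric.eventually_nhds_iff.1 (eventually_nhdsWithin_iff.1 hC)
  refine ⟨min ε (1 / (|C| + 1)), by positivity, fun η hη hη' s hs => ?_⟩
  refine (norm_logDeriv_riemannZeta_le (σ := 1 + η) (by linarith) hs).trans ?_
  have h1 := hb (y := ((1 + η : ℝ) : ℂ)) (by
    simp only [Complex.ofReal_add, Complex.ofReal_one, dist_self_add_left, Complex.norm_real]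
    rw [Real.norm_of_nonneg hη.le]
    exact hη'.trans_le (min_le_left _ _)) (by simpa using hη.ne')
  have h2 : η * (|C| + 1) ≤ 1 := by
    have := hη'.le.trans (min_le_right _ _)
    rwa [le_div_iff₀ (by positivity)] at this
  have h3 : ‖(((1 + η : ℝ) : ℂ) - 1)⁻¹‖ = 1 / η := by
    simp [abs_of_pos hη]
  have h4 : ‖deriv riemannZeta ((1 + η : ℝ) : ℂ) / riemannZeta ((1 + η : ℝ) : ℂ)‖ ≤ C + 1 / η := by
    rw [← h3]
    refine (norm_le_norm_add_norm_sub' _ (-(((1 + η : ℝ) : ℂ) - 1)⁻¹)).trans ?_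
    rw [norm_neg, sub_neg_eq_add, add_comm]
    gcongr
    simpa using h1
  refine h4.trans ?_
  rw [← sub_nonneg]
  have : 2 / η - (C + 1 / η) = (1 - C * η) / η := by field_simp; ring
  rw [this]
  refine div_nonneg ?_ hη.le
  nlinarith [le_abs_self C]

/-- The terms after the first sum to at most `π² / 6 - 1 < 2 / 3`. -/
lemma one_third_le_norm_riemannZeta {s : ℂ} (hs : 2 ≤ s.re) : 1 / 3 ≤ ‖riemannZeta s‖ := by
  have hs1 : 1 < s.re := by linarith
  have hsum : Summable fun n : ℕ => 1 / ((n : ℂ) + 1) ^ s := by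
    have := (summable_nat_add_iff 1).2 (Complex.summable_one_div_nat_cpow.2 hs1)
    simpa using this
  have hz : riemannZeta s = 1 + ∑' n : ℕ, 1 / ((n : ℂ) + 1 + 1) ^ s := by
    rw [zeta_eq_tsum_one_div_nat_add_one_cpow hs1, hsum.tsum_eq_zero_add]
    simp
  have h2 : HasSum (fun n : ℕ => 1 / ((n : ℝ) + 1 + 1) ^ 2) (Real.pi ^ 2 / 6 - 1) := by
    have := (hasSum_nat_add_iff' 2).2 hasSum_zeta_two
    rw [show Real.pi ^ 2 / 6 - 1 = Real.pi ^ 2 / 6 -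
      ∑ i ∈ Finset.range 2, 1 / ((i : ℕ) : ℝ) ^ 2 by simp [Finset.sum_range_succ]]
    have e : (fun n : ℕ => 1 / ((n : ℝ) + 1 + 1) ^ 2) = fun n : ℕ => 1 / ((n + 2 : ℕ) : ℝ) ^ 2 := by
      funext n
      rw [Nat.cast_add, Nat.cast_two, add_assoc, one_add_one_eq_two]
    rw [e]
    exact this
  have h3 : ‖∑' n : ℕ, 1 / ((n : ℂ) + 1 + 1) ^ s‖ ≤ Real.pi ^ 2 / 6 - 1 := by
    refine tsum_of_norm_bounded h2 fun n => ?_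
    have hc := Complex.norm_cpow_eq_rpow_re_of_pos (x := (n : ℝ) + 1 + 1) (by positivity) s
    push_cast at hc
    rw [norm_div, norm_one, hc, ← Real.rpow_natCast]
    gcongr
    · linarith [(Nat.cast_nonneg n : (0 : ℝ) ≤ n)]
    · simpa using hs
  have h4 : Real.pi ^ 2 < 3.15 ^ 2 :=
    pow_lt_pow_left₀ Real.pi_lt_d2 Real.pi_pos.le (by norm_num)
  have h5 : ‖(1 : ℂ)‖ ≤ ‖riemannZeta s‖ + ‖∑' n : ℕ, 1 / ((n : ℂ) + 1 + 1) ^ s‖ := by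
    have := norm_sub_le (riemannZeta s) (∑' n : ℕ, 1 / ((n : ℂ) + 1 + 1) ^ s)
    rwa [hz, add_sub_cancel_right, ← hz] at this
  rw [norm_one] at h5
  linarith

/-! ### Consequences of the Riemann hypothesis near the line `re s = 1` -/

lemma RiemannHypothesis.riemannZeta_ne_zero (hRH : RiemannHypothesis) {s : ℂ}
    (hs : 1 / 2 < s.re) (h1 : s ≠ 1) : riemannZeta s ≠ 0 := by
  intro h0
  have := hRH s h0 ?_ h1
  · linarith
  · rintro ⟨n, rfl⟩
    have h : (-2 * ((n : ℂ) + 1)).re = -2 * ((n : ℝ) + 1) := by simp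
    rw [h] at hs
    linarith [(Nat.cast_nonneg n : (0 : ℝ) ≤ n)]

/-- About the centre `σ + 1 + it`, the target `σ + it` has distance `1`. The radii `5 / 4` and `11 /
8` go beyond it, yet the disc stays in `re z > 5 / 8`, inside the zero-free region. -/
lemma mem_ball_riemannZeta {σ t R : ℝ} {z : ℂ} (hσ : 1 ≤ σ) (hσ' : σ ≤ 2) (ht : 3 ≤ t)
    (hR : R ≤ 11 / 8) (hz : z ∈ Metric.ball ((σ : ℂ) + 1 + Complex.I * t) R) :
    5 / 8 < z.re ∧ z ≠ 1 ∧ 1 ≤ ‖z - 1‖ ∧ ‖z‖ ≤ t + 6 := by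
  have hz' : ‖z - ((σ : ℂ) + 1 + Complex.I * t)‖ < 11 / 8 := by
    rw [← dist_eq_norm]; exact (Metric.mem_ball.1 hz).trans_le hR
  have hre := (Complex.abs_re_le_norm _).trans_lt hz'
  have him := (Complex.abs_im_le_norm _).trans_lt hz'
  simp at hre him
  rw [abs_lt] at hre him
  have h1 : 1 ≤ ‖z - 1‖ := by
    refine le_trans ?_ (Complex.abs_im_le_norm _)
    refine le_trans ?_ (le_abs_self _)
    simp
    linarith
  refine ⟨by linarith, ?_, h1, ?_⟩
  · rintro rfl
    simp at h1
    linarith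
  · have h3 : ‖(σ : ℂ) + 1 + Complex.I * t‖ ≤ 3 + t := by
      refine (norm_add₃_le).trans ?_
      simp only [norm_mul, Complex.norm_real, Complex.norm_I, norm_one, Real.norm_eq_abs]
      rw [abs_of_nonneg (by linarith), abs_of_nonneg (by linarith)]
      linarith
    have := norm_le_norm_add_norm_sub' z ((σ : ℂ) + 1 + Complex.I * t)
    linarith

lemma differentiableOn_riemannZeta_ball {σ t R : ℝ} (hσ : 1 ≤ σ) (hσ' : σ ≤ 2) (ht : 3 ≤ t)
    (hR : R ≤ 11 / 8) :
    DifferentiableOn ℂ riemannZeta (Metric.ball ((σ : ℂ) + 1 + Complex.I * t) R) := fun _ hz =>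
  (differentiableAt_riemannZeta (mem_ball_riemannZeta hσ hσ' ht hR hz).2.1).differentiableWithinAt

lemma RiemannHypothesis.exists_norm_logDeriv_le_log (hRH : RiemannHypothesis) :
    ∃ K : ℝ, 0 < K ∧ ∀ᶠ t : ℝ in atTop, ∀ σ : ℝ, 1 ≤ σ → σ ≤ 2 → ∀ z : ℂ,
      ‖z - ((σ : ℂ) + 1 + Complex.I * t)‖ ≤ 5 / 4 →
      ‖deriv riemannZeta z / riemannZeta z‖ ≤ K * Real.log t := by
  obtain ⟨C, hC, hzeta⟩ := exists_norm_riemannZeta_le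
  refine ⟨8 * (11 / 8) / (11 / 8 - 5 / 4) ^ 2 * 2, by norm_num, ?_⟩
  -- The second threshold ensures `1 + C (t + 6) ≤ t² / 3`, so the growth relative to the centre is
  -- at most `exp (2 log t)`.
  filter_upwards [eventually_ge_atTop 3, eventually_ge_atTop (3 * (1 + 7 * C))]
    with t ht ht2 σ hσ hσ' z hz
  have ht0 : 0 < t := by linarith
  have hlog : 0 < Real.log t := Real.log_pos (by linarith)
  rw [mul_assoc]
  refine norm_logDeriv_le_of_norm_le_exp (by norm_num) (by norm_num) (by positivity)
    (differentiableOn_riemannZeta_ball hσ hσ' ht le_rfl) (fun w hw => ?_) (fun w hw => ?_) hz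
  · obtain ⟨h1, h2, -⟩ := mem_ball_riemannZeta hσ hσ' ht le_rfl hw
    exact hRH.riemannZeta_ne_zero (by linarith) h2
  · obtain ⟨h1, h2, h3, h4⟩ := mem_ball_riemannZeta hσ hσ' ht le_rfl hw
    have hlow : 1 / 3 ≤ ‖riemannZeta ((σ : ℂ) + 1 + Complex.I * t)‖ :=
      one_third_le_norm_riemannZeta (by simp; linarith)
    have hexp : Real.exp (2 * Real.log t) = t ^ 2 := by
      rw [two_mul, Real.exp_add, Real.exp_log ht0, sq]
    rw [hexp]
    calc ‖riemannZeta w‖ ≤ 1 / ‖w - 1‖ + C * ‖w‖ := hzeta w (by linarith) h2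
      _ ≤ 1 + C * (t + 6) := by
        gcongr
        rw [div_le_one (by linarith)]; exact h3
      _ ≤ 1 / 3 * t ^ 2 := by nlinarith
      _ ≤ _ := by gcongr

/-- This quotient is the three-circle exponent at radius `1` between radii `1 - η` and `5 / 4`. Its
numerator is at most `2 η` and its denominator at least `log (5 / 4) ≥ 1 / 5`. -/
lemma log_inv_div_log_le {η : ℝ} (h0 : 0 < η) (h1 : η ≤ 1 / 2) :
    0 ≤ Real.log (1 / (1 - η)) / Real.log (5 / 4 / (1 - η)) ∧
    Real.log (1 / (1 - η)) / Real.log (5 / 4 / (1 - η)) ≤ min 1 (10 * η) := by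
  have hp : 0 < 1 - η := by linarith
  have hnum0 : 0 ≤ Real.log (1 / (1 - η)) :=
    Real.log_nonneg (by rw [le_div_iff₀ hp]; linarith)
  have hnum : Real.log (1 / (1 - η)) ≤ 2 * η := by
    refine (Real.log_le_sub_one_of_pos (by positivity)).trans ?_
    rw [div_sub_one hp.ne', div_le_iff₀ hp]
    nlinarith
  have h54 : (1 / 5 : ℝ) ≤ Real.log (5 / 4) := by
    have := Real.one_sub_inv_le_log_of_pos (show (0 : ℝ) < 5 / 4 by norm_num)
    norm_num at this ⊢
    exact this
  have hden : Real.log (5 / 4 / (1 - η)) = Real.log (5 / 4) + Real.log (1 / (1 - η)) := by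
    rw [← Real.log_mul (by norm_num) (by positivity)]
    congr 1
    ring
  rw [hden]
  have hd0 : 0 < Real.log (5 / 4) + Real.log (1 / (1 - η)) := by linarith
  refine ⟨by positivity, le_min ?_ ?_⟩
  · rw [div_le_one hd0]; linarith
  · rw [div_le_iff₀ hd0]; nlinarith

/-- Under the Riemann hypothesis, `ζ'/ζ` is `O(log log T)` just to the right of the line
`re s = 1`. -/
theorem RiemannHypothesis.exists_norm_logDeriv_le_log_log (hRH : RiemannHypothesis) :
    ∃ K : ℝ, 0 < K ∧ ∀ᶠ T : ℝ in atTop, ∀ t ∈ Set.Icc T (2 * T), ∀ σ : ℝ, 1 ≤ σ → σ ≤ 2 →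
      ‖deriv riemannZeta ((σ : ℂ) + Complex.I * t) / riemannZeta ((σ : ℂ) + Complex.I * t)‖
        ≤ K * Real.log (Real.log T) := by
  obtain ⟨K, hK, hlogbd⟩ := hRH.exists_norm_logDeriv_le_log
  obtain ⟨η₀, hη₀, hinner⟩ := exists_norm_logDeriv_riemannZeta_le
  obtain ⟨T₀, hT₀⟩ := eventually_atTop.1 hlogbd
  have hll : Tendsto (fun T => Real.log (Real.log T)) atTop atTop :=
    Real.tendsto_log_atTop.comp Real.tendsto_log_atTop
  refine ⟨2 * Real.exp 20, by positivity, ?_⟩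
  filter_upwards [eventually_ge_atTop T₀, eventually_ge_atTop 3, hll.eventually_ge_atTop 2,
    hll.eventually_gt_atTop (1 / η₀), Real.tendsto_log_atTop.eventually_ge_atTop 1,
    Real.tendsto_log_atTop.eventually_ge_atTop (2 * K)]
    with T hT0 hT3 hl2 hlη hl1 hlK t ht σ hσ hσ'
  set l := Real.log (Real.log T)
  have hl0 : 0 < l := by linarith
  have ht3 : 3 ≤ t := hT3.trans ht.1
  have hη0 : 0 < 1 / l := by positivity
  have hη2 : 1 / l ≤ 1 / 2 := one_div_le_one_div_of_le (by norm_num) hl2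
  have hη3 : 1 / l < η₀ := by rw [div_lt_iff₀ hl0]; rwa [div_lt_iff₀ hη₀, mul_comm] at hlη
  obtain ⟨hθ0, hθ⟩ := log_inv_div_log_le hη0 hη2
  have hzc : ‖((σ : ℂ) + Complex.I * t) - ((σ : ℂ) + 1 + Complex.I * t)‖ = 1 := by
    rw [show ((σ : ℂ) + Complex.I * t) - ((σ : ℂ) + 1 + Complex.I * t) = -1 by ring]
    simp
  have hd : DifferentiableOn ℂ (fun z => deriv riemannZeta z / riemannZeta z)
      (Metric.ball ((σ : ℂ) + 1 + Complex.I * t) (11 / 8)) := by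
    have h := differentiableOn_riemannZeta_ball hσ hσ' ht3 le_rfl
    refine (h.deriv Metric.isOpen_ball).div h fun w hw => ?_
    obtain ⟨h1, h2, -⟩ := mem_ball_riemannZeta hσ hσ' ht3 le_rfl hw
    exact hRH.riemannZeta_ne_zero (by linarith) h2
  -- The inner circle lies in `re w ≥ 1 + 1 / l`, which gives `2 * l`. On the outer one `K log t ≤ 2
  -- K log T ≤ (log T)²`.
  have key := norm_le_interp_of_three_circles (z := (σ : ℂ) + Complex.I * t) (r₁ := 1 - 1 / l)
    (r₂ := 5 / 4) (a := 2 * l) (b := Real.log T ^ 2) (by linarith) (by linarith) (by norm_num) hd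
    (fun w hw => ?_) (fun w hw => ?_) (by rw [hzc]; linarith) (by rw [hzc]; norm_num)
  · rw [hzc] at key
    refine key.trans ?_
    set θ := Real.log (1 / (1 - 1 / l)) / Real.log (5 / 4 / (1 - 1 / l))
    have e1 : (2 * l) ^ (1 - θ) ≤ 2 * l := by
      conv_rhs => rw [← Real.rpow_one (2 * l)]
      exact Real.rpow_le_rpow_of_exponent_le (by linarith) (by linarith)
    -- The exponent `θ ≤ 10 / l` exactly cancels `log (log T) = l`.
    have e2 : (Real.log T ^ 2) ^ θ ≤ Real.exp 20 := by
      have hlp : 0 < Real.log T := by linarith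
      rw [Real.rpow_def_of_pos (by positivity), Real.log_pow, Real.exp_le_exp]
      calc ((2 : ℕ) : ℝ) * l * θ ≤ ((2 : ℕ) : ℝ) * l * (10 * (1 / l)) := by
            gcongr; exact hθ.trans (min_le_right _ _)
        _ = 20 := by push_cast; field_simp; norm_num
    calc (2 * l) ^ (1 - θ) * (Real.log T ^ 2) ^ θ ≤ 2 * l * Real.exp 20 := by gcongr
      _ = 2 * Real.exp 20 * l := by ring
  · have := hinner (1 / l) hη0 hη3 w ?_
    · simpa using this
    · have h := (Complex.abs_re_le_norm _).trans hw.le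
      simp at h
      rw [abs_le] at h
      simp
      linarith
  · refine (hT₀ t (hT0.trans ht.1) σ hσ hσ' w hw.le).trans ?_
    have hlog : Real.log t ≤ 2 * Real.log T := by
      rw [← Real.log_rpow (by linarith)]
      refine Real.log_le_log (by linarith) ?_
      have : T ^ (2 : ℝ) = T ^ 2 := by norm_cast
      rw [this]
      nlinarith [ht.2]
    nlinarith

/-- Under the Riemann hypothesis, `|ζ|` changes by a bounded factor between the lines `re s = 1`
and `re s = 1 + 1 / log log T`. -/
theorem RiemannHypothesis.exists_norm_riemannZeta_comparison (hRH : RiemannHypothesis) :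
    ∃ K : ℝ, 0 < K ∧ ∀ᶠ T : ℝ in atTop, ∀ t ∈ Set.Icc T (2 * T),
      ‖riemannZeta (1 + Complex.I * t)‖ ≤
        K * ‖riemannZeta ((1 + 1 / Real.log (Real.log T) : ℝ) + Complex.I * t)‖ ∧
      ‖riemannZeta (1 + Complex.I * t)‖⁻¹ ≤
        K * ‖riemannZeta ((1 + 1 / Real.log (Real.log T) : ℝ) + Complex.I * t)‖⁻¹ := by
  obtain ⟨K, hK, hbd⟩ := hRH.exists_norm_logDeriv_le_log_log
  have hll : Tendsto (fun T => Real.log (Real.log T)) atTop atTop :=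
    Real.tendsto_log_atTop.comp Real.tendsto_log_atTop
  refine ⟨Real.exp K, Real.exp_pos _, ?_⟩
  filter_upwards [hbd, eventually_ge_atTop 3, hll.eventually_ge_atTop 2] with T hT hT3 hl2 t ht
  have ht3 : 3 ≤ t := hT3.trans ht.1
  set l := Real.log (Real.log T)
  have hl0 : 0 < l := by linarith
  have hη0 : 0 < 1 / l := by positivity
  have hη2 : 1 / l ≤ 1 / 2 := one_div_le_one_div_of_le (by norm_num) hl2
  have hne : ∀ w ∈ Metric.ball (((1 : ℝ) : ℂ) + 1 + Complex.I * t) (11 / 8), riemannZeta w ≠ 0 := by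
    intro w hw
    obtain ⟨h1, h2, -⟩ := mem_ball_riemannZeta le_rfl one_le_two ht3 le_rfl hw
    exact hRH.riemannZeta_ne_zero (by linarith) h2
  obtain ⟨g, -, hg, hzg⟩ := exists_log_of_ne_zero_on_ball (by norm_num)
    (differentiableOn_riemannZeta_ball le_rfl one_le_two ht3 le_rfl) hne
  have hmem : ∀ x ∈ Set.Icc (1 : ℝ) (1 + 1 / l), (x : ℂ) + Complex.I * t ∈
      Metric.ball (((1 : ℝ) : ℂ) + 1 + Complex.I * t) (11 / 8) := by
    intro x hx
    rw [Metric.mem_ball, dist_eq_norm, show (x : ℂ) + Complex.I * t -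
      (((1 : ℝ) : ℂ) + 1 + Complex.I * t) = ((x - 2 : ℝ) : ℂ) by push_cast; ring,
      Complex.norm_real, Real.norm_eq_abs, abs_lt]
    constructor <;> linarith [hx.1, hx.2]
  -- The logarithm `g` has derivative at most `K * l` on a segment of length `1 / l`, so it changes
  -- by at most `K`.
  have hdiff := (convex_Icc (1 : ℝ) (1 + 1 / l)).norm_image_sub_le_of_norm_hasDerivWithin_le
    (f := fun x : ℝ => g ((x : ℂ) + Complex.I * t)) (C := K * l)
    (fun x hx => ((hg _ (hmem x hx)).comp_add_const (x : ℂ)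
      (Complex.I * t)).comp_ofReal.hasDerivWithinAt)
    (fun x hx => hT t ht x hx.1 (by linarith [hx.2]))
    (Set.left_mem_Icc.2 (by linarith)) (Set.right_mem_Icc.2 (by linarith))
  have hdiff' : ‖g (((1 + 1 / l : ℝ) : ℂ) + Complex.I * t) - g (((1 : ℝ) : ℂ) + Complex.I * t)‖
      ≤ K := by
    refine hdiff.trans (le_of_eq ?_)
    rw [add_sub_cancel_left, Real.norm_of_nonneg hη0.le]
    field_simp
  have habs := abs_le.1 ((Complex.abs_re_le_norm _).trans hdiff')
  rw [Complex.sub_re] at habs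
  have m1 := hmem 1 (Set.left_mem_Icc.2 (by linarith))
  have m2 := hmem (1 + 1 / l) (Set.right_mem_Icc.2 (by linarith))
  have n2 : 0 < ‖riemannZeta (((1 + 1 / l : ℝ) : ℂ) + Complex.I * t)‖ :=
    norm_pos_iff.2 (hne _ m2)
  have n1 : 0 < ‖riemannZeta (((1 : ℝ) : ℂ) + Complex.I * t)‖ := norm_pos_iff.2 (hne _ m1)
  have N1 := congrArg norm (hzg _ m1)
  have N2 := congrArg norm (hzg _ m2)
  rw [norm_mul, Complex.norm_exp] at N1 N2
  have a1 : ‖riemannZeta (((1 : ℝ) : ℂ) + Complex.I * t)‖ ≤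
      Real.exp K * ‖riemannZeta (((1 + 1 / l : ℝ) : ℂ) + Complex.I * t)‖ := by
    rw [N1, N2, mul_left_comm, ← Real.exp_add]
    gcongr
    linarith
  have a2 : ‖riemannZeta (((1 + 1 / l : ℝ) : ℂ) + Complex.I * t)‖ ≤
      Real.exp K * ‖riemannZeta (((1 : ℝ) : ℂ) + Complex.I * t)‖ := by
    rw [N1, N2, mul_left_comm, ← Real.exp_add]
    gcongr
    linarith
  rw [Complex.ofReal_one] at a1 a2 n1
  refine ⟨a1, ?_⟩
  rw [← div_eq_mul_inv, inv_eq_one_div, div_le_div_iff₀ n1 n2, one_mul]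
  exact a2

/-! ### The Gaussian majorant principle -/

/-- The Fourier transform of `f (· + T)` against the Gaussian weight `exp (-t ^ 2)`. -/
noncomputable def gaussTransform (f : ℝ → ℝ) (T l : ℝ) : ℂ :=
  ∫ t : ℝ, ((Real.exp (-t ^ 2) * f (t + T) : ℝ) : ℂ) * Complex.exp (Complex.I * l * t)

/-- `f` is majorized by `g` if, with respect to the Gaussian weight, the Fourier transforms of all
translates of `f` are dominated by the Fourier transform of `g`. -/
structure GaussMajorized (f g : ℝ → ℝ) : Prop where
  measurable_left : Measurable f
  measurable_right : Measurable g
  bounded : ∃ B, ∀ t, |f t| ≤ B ∧ |g t| ≤ B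
  norm_le : ∀ T l, ‖gaussTransform f T l‖ ≤ (gaussTransform g 0 l).re

/-- Multiplication by the pair `(u, v)` preserves Gaussian majorization. -/
structure GaussMultiplier (u v : ℝ → ℝ) : Prop where
  measurable_left : Measurable u
  measurable_right : Measurable v
  bounded : ∃ B, ∀ t, |u t| ≤ B ∧ |v t| ≤ B
  mul : ∀ f g, GaussMajorized f g → GaussMajorized (fun t => f t * u t) (fun t => g t * v t)

lemma norm_gaussTransform_integrand_le {f : ℝ → ℝ} {B : ℝ} (hb : ∀ t, |f t| ≤ B) (T l t : ℝ) :
    ‖((Real.exp (-t ^ 2) * f (t + T) : ℝ) : ℂ) * Complex.exp (Complex.I * l * t)‖ ≤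
      B * Real.exp (-t ^ 2) := by
  have : ‖Complex.exp (Complex.I * l * t)‖ = 1 := by
    rw [Complex.norm_exp]; simp
  rw [norm_mul, this, mul_one, Complex.norm_real, Real.norm_eq_abs, abs_mul,
    abs_of_pos (Real.exp_pos _), mul_comm]
  gcongr
  exact hb _

lemma integrable_const_mul_gauss (B : ℝ) :
    MeasureTheory.Integrable fun t : ℝ => B * Real.exp (-t ^ 2) := by
  have := (integrable_exp_neg_mul_sq (b := 1) one_pos).const_mul B
  simpa using this

lemma measurable_gaussTransform_integrand {f : ℝ → ℝ} (hf : Measurable f) (T l : ℝ) :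
    Measurable fun t : ℝ =>
      ((Real.exp (-t ^ 2) * f (t + T) : ℝ) : ℂ) * Complex.exp (Complex.I * l * t) := by
  have : Measurable fun t : ℝ => f (t + T) := hf.comp (measurable_id.add_const T)
  fun_prop

lemma integrable_gaussTransform_integrand {f : ℝ → ℝ} (hf : Measurable f) {B : ℝ}
    (hb : ∀ t, |f t| ≤ B) (T l : ℝ) : MeasureTheory.Integrable fun t : ℝ =>
      ((Real.exp (-t ^ 2) * f (t + T) : ℝ) : ℂ) * Complex.exp (Complex.I * l * t) :=
  (integrable_const_mul_gauss B).mono' (measurable_gaussTransform_integrand hf T l).aestronglyMeasurable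
    (Eventually.of_forall fun t => norm_gaussTransform_integrand_le hb T l t)

lemma gaussTransform_add {f g : ℝ → ℝ} (hf : Measurable f) (hg : Measurable g) {B C : ℝ}
    (hB : ∀ t, |f t| ≤ B) (hC : ∀ t, |g t| ≤ C) (T l : ℝ) :
    gaussTransform (fun t => f t + g t) T l = gaussTransform f T l + gaussTransform g T l := by
  unfold gaussTransform
  rw [← MeasureTheory.integral_add (integrable_gaussTransform_integrand hf hB T l)
    (integrable_gaussTransform_integrand hg hC T l)]
  congr 1
  ext t
  push_cast
  ring

lemma gaussTransform_mul_cos {f : ℝ → ℝ} (hf : Measurable f) {B : ℝ} (hB : ∀ t, |f t| ≤ B)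
    (a ν T l : ℝ) : gaussTransform (fun t => f t * (a * Real.cos (ν * t))) T l =
      a / 2 * Complex.exp (Complex.I * ν * T) * gaussTransform f T (l + ν) +
      a / 2 * Complex.exp (-(Complex.I * ν * T)) * gaussTransform f T (l - ν) := by
  unfold gaussTransform
  rw [← MeasureTheory.integral_const_mul, ← MeasureTheory.integral_const_mul,
    ← MeasureTheory.integral_add
      ((integrable_gaussTransform_integrand hf hB T (l + ν)).const_mul _)
      ((integrable_gaussTransform_integrand hf hB T (l - ν)).const_mul _)]
  congr 1
  ext t
  have e1 : Complex.exp (Complex.I * ν * T) * Complex.exp (Complex.I * (l + ν) * t) =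
      Complex.exp (Complex.I * l * t) * Complex.exp (ν * (t + T) * Complex.I) := by
    rw [← Complex.exp_add, ← Complex.exp_add]; ring_nf
  have e2 : Complex.exp (-(Complex.I * ν * T)) * Complex.exp (Complex.I * (l - ν) * t) =
      Complex.exp (Complex.I * l * t) * Complex.exp (-(ν * (t + T)) * Complex.I) := by
    rw [← Complex.exp_add, ← Complex.exp_add]; ring_nf
  push_cast
  rw [Complex.cos]
  linear_combination (-(a : ℂ) / 2 * Complex.exp (-t ^ 2) * f (t + T)) * e1 +
    (-(a : ℂ) / 2 * Complex.exp (-t ^ 2) * f (t + T)) * e2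

namespace GaussMajorized

/-- The Gaussian weight is chosen for this: its Fourier transform is positive at every frequency. -/
lemma one : GaussMajorized (fun _ => 1) (fun _ => 1) := by
  refine ⟨measurable_const, measurable_const, ⟨1, fun t => by simp⟩, fun T l => ?_⟩
  have h : ∀ T, gaussTransform (fun _ => 1) T l =
      ((Real.sqrt Real.pi * Real.exp (-l ^ 2 / 4) : ℝ) : ℂ) := by
    intro T
    have := fourierIntegral_gaussian (b := 1) (by simp) (l : ℂ)
    unfold gaussTransform
    simp only [mul_one]
    rw [Real.sqrt_eq_rpow, Complex.ofReal_mul, Complex.ofReal_cpow Real.pi_pos.le]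
    push_cast
    rw [div_one, mul_one] at this
    rw [← this]
    congr 1
    ext t
    ring_nf
  rw [h, h, Complex.norm_real, Complex.ofReal_re, Real.norm_of_nonneg (by positivity)]

lemma add {f g f' g' : ℝ → ℝ} (h : GaussMajorized f g) (h' : GaussMajorized f' g') :
    GaussMajorized (fun t => f t + f' t) (fun t => g t + g' t) := by
  obtain ⟨B, hB⟩ := h.bounded
  obtain ⟨C, hC⟩ := h'.bounded
  refine ⟨h.measurable_left.add h'.measurable_left, h.measurable_right.add h'.measurable_right,
    ⟨B + C, fun t => ⟨?_, ?_⟩⟩, fun T l => ?_⟩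
  · exact (abs_add_le _ _).trans (add_le_add (hB t).1 (hC t).1)
  · exact (abs_add_le _ _).trans (add_le_add (hB t).2 (hC t).2)
  · rw [gaussTransform_add h.measurable_left h'.measurable_left (fun t => (hB t).1)
      (fun t => (hC t).1), gaussTransform_add h.measurable_right h'.measurable_right
      (fun t => (hB t).2) (fun t => (hC t).2), Complex.add_re]
    exact (norm_add_le _ _).trans (add_le_add (h.norm_le T l) (h'.norm_le T l))

/-- A cosine shifts the frequency by `±ν`, and translation by `T` contributes only phases, absent at
`T = 0`. Majorization is required at all frequencies to survive these shifts. -/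
lemma mul_cos {f g : ℝ → ℝ} (h : GaussMajorized f g) {a c : ℝ} (hac : |a| ≤ c) (ν : ℝ) :
    GaussMajorized (fun t => f t * (a * Real.cos (ν * t)))
      (fun t => g t * (c * Real.cos (ν * t))) := by
  obtain ⟨B, hB⟩ := h.bounded
  have hB0 : 0 ≤ B := (abs_nonneg _).trans (hB 0).1
  have hc : 0 ≤ c := (abs_nonneg _).trans hac
  have hcos : Measurable fun t => Real.cos (ν * t) := by fun_prop
  have hb : ∀ {x d y : ℝ}, |x| ≤ B → |d| ≤ c → |x * (d * Real.cos y)| ≤ B * c := by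
    intro x d y hx hd
    rw [abs_mul, abs_mul]
    have := mul_le_mul hd (Real.abs_cos_le_one y) (abs_nonneg _) hc
    rw [mul_one] at this
    exact mul_le_mul hx this (by positivity) hB0
  refine ⟨h.measurable_left.mul (hcos.const_mul a), h.measurable_right.mul (hcos.const_mul c),
    ⟨B * c, fun t => ⟨hb (hB t).1 hac, hb (hB t).2 (abs_of_nonneg hc).le⟩⟩, fun T l => ?_⟩
  rw [gaussTransform_mul_cos h.measurable_left (fun t => (hB t).1),
    gaussTransform_mul_cos h.measurable_right (fun t => (hB t).2)]
  have hexp : ∀ x : ℝ, ‖Complex.exp (Complex.I * ν * x)‖ = 1 ∧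
      ‖Complex.exp (-(Complex.I * ν * x))‖ = 1 := by
    intro x
    constructor <;> · rw [Complex.norm_exp]; simp
  have ha : ‖(a : ℂ) / 2‖ ≤ c / 2 := by
    rw [norm_div, Complex.norm_real, Complex.norm_two]
    exact div_le_div_of_nonneg_right hac zero_le_two
  have hre : ∀ w : ℂ, ((c : ℂ) / 2 * w).re = c / 2 * w.re := by
    intro w
    rw [show (c : ℂ) / 2 = ((c / 2 : ℝ) : ℂ) by push_cast; rfl, Complex.re_ofReal_mul]
  simp only [Complex.ofReal_zero, mul_zero, neg_zero, Complex.exp_zero, mul_one, Complex.add_re,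
    hre]
  refine (norm_add_le _ _).trans (add_le_add ?_ ?_)
  · rw [norm_mul, norm_mul, (hexp T).1, mul_one]
    exact mul_le_mul ha (h.norm_le _ _) (norm_nonneg _) (by positivity)
  · rw [norm_mul, norm_mul, (hexp T).2, mul_one]
    exact mul_le_mul ha (h.norm_le _ _) (norm_nonneg _) (by positivity)

lemma of_tendsto {F G : ℕ → ℝ → ℝ} {f g : ℝ → ℝ} (h : ∀ n, GaussMajorized (F n) (G n)) {B : ℝ}
    (hB : ∀ n t, |F n t| ≤ B ∧ |G n t| ≤ B)
    (hf : ∀ t, Tendsto (fun n => F n t) atTop (nhds (f t)))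
    (hg : ∀ t, Tendsto (fun n => G n t) atTop (nhds (g t))) : GaussMajorized f g := by
  have hlim : ∀ {F : ℕ → ℝ → ℝ} {f : ℝ → ℝ}, (∀ n, Measurable (F n)) → (∀ n t, |F n t| ≤ B) →
      (∀ t, Tendsto (fun n => F n t) atTop (nhds (f t))) → ∀ T l,
      Tendsto (fun n => gaussTransform (F n) T l) atTop (nhds (gaussTransform f T l)) := by
    intro F f hm hb ht T l
    refine MeasureTheory.tendsto_integral_of_dominated_convergence
      (fun t => B * Real.exp (-t ^ 2))
      (fun n => (measurable_gaussTransform_integrand (hm n) T l).aestronglyMeasurable)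
      (integrable_const_mul_gauss B)
      (fun n => Eventually.of_forall fun t => norm_gaussTransform_integrand_le (hb n) T l t)
      (Eventually.of_forall fun t => ?_)
    refine Tendsto.mul_const _ ?_
    exact (Complex.continuous_ofReal.tendsto _).comp ((ht (t + T)).const_mul _)
  refine ⟨measurable_of_tendsto_metrizable (fun n => (h n).measurable_left)
      (tendsto_pi_nhds.2 hf), measurable_of_tendsto_metrizable (fun n => (h n).measurable_right)
      (tendsto_pi_nhds.2 hg), ⟨B, fun t => ⟨?_, ?_⟩⟩, fun T l => ?_⟩
  · exact le_of_tendsto (hf t).abs (Eventually.of_forall fun n => (hB n t).1)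
  · exact le_of_tendsto (hg t).abs (Eventually.of_forall fun n => (hB n t).2)
  · refine le_of_tendsto_of_tendsto
      (hlim (fun n => (h n).measurable_left) (fun n t => (hB n t).1) hf T l).norm
      ((Complex.continuous_re.tendsto _).comp
        (hlim (fun n => (h n).measurable_right) (fun n t => (hB n t).2) hg 0 l))
      (Eventually.of_forall fun n => (h n).norm_le T l)

lemma integral_le {f g : ℝ → ℝ} (h : GaussMajorized f g) (T : ℝ) :
    ∫ t, Real.exp (-t ^ 2) * f (t + T) ≤ ∫ t, Real.exp (-t ^ 2) * g t := by
  have e : ∀ (f : ℝ → ℝ) (T : ℝ), gaussTransform f T 0 =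
      ((∫ t, Real.exp (-t ^ 2) * f (t + T) : ℝ) : ℂ) := by
    intro f T
    unfold gaussTransform
    rw [← integral_complex_ofReal]
    simp
  have := h.norm_le T 0
  rw [e, e, Complex.norm_real, Complex.ofReal_re, Real.norm_eq_abs] at this
  simpa using (le_abs_self _).trans this

end GaussMajorized

namespace GaussMultiplier

lemma cos {a c : ℝ} (hac : |a| ≤ c) (ν : ℝ) :
    GaussMultiplier (fun t => a * Real.cos (ν * t)) (fun t => c * Real.cos (ν * t)) := by
  have hc : 0 ≤ c := (abs_nonneg _).trans hac
  refine ⟨by fun_prop, by fun_prop, ⟨c, fun t => ?_⟩, fun f g h => h.mul_cos hac ν⟩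
  rw [abs_mul, abs_mul, abs_of_nonneg hc]
  have := Real.abs_cos_le_one (ν * t)
  exact ⟨(mul_le_of_le_one_right (abs_nonneg _) this).trans hac, mul_le_of_le_one_right hc this⟩

lemma const {a c : ℝ} (hac : |a| ≤ c) : GaussMultiplier (fun _ => a) (fun _ => c) := by
  simpa using cos hac 0

lemma add {u v u' v' : ℝ → ℝ} (h : GaussMultiplier u v) (h' : GaussMultiplier u' v') :
    GaussMultiplier (fun t => u t + u' t) (fun t => v t + v' t) := by
  obtain ⟨B, hB⟩ := h.bounded
  obtain ⟨C, hC⟩ := h'.bounded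
  refine ⟨h.measurable_left.add h'.measurable_left, h.measurable_right.add h'.measurable_right,
    ⟨B + C, fun t => ⟨?_, ?_⟩⟩, fun f g hfg => ?_⟩
  · exact (abs_add_le _ _).trans (add_le_add (hB t).1 (hC t).1)
  · exact (abs_add_le _ _).trans (add_le_add (hB t).2 (hC t).2)
  · simpa only [mul_add] using (h.mul f g hfg).add (h'.mul f g hfg)

/-- Multipliers act on every majorized pair, so a product is just one action after the other. -/
lemma mul_mul {u v u' v' : ℝ → ℝ} (h : GaussMultiplier u v) (h' : GaussMultiplier u' v') :
    GaussMultiplier (fun t => u t * u' t) (fun t => v t * v' t) := by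
  obtain ⟨B, hB⟩ := h.bounded
  obtain ⟨C, hC⟩ := h'.bounded
  have hB0 : 0 ≤ B := (abs_nonneg _).trans (hB 0).1
  refine ⟨h.measurable_left.mul h'.measurable_left, h.measurable_right.mul h'.measurable_right,
    ⟨B * C, fun t => ⟨?_, ?_⟩⟩, fun f g hfg => ?_⟩
  · rw [abs_mul]; exact mul_le_mul (hB t).1 (hC t).1 (abs_nonneg _) hB0
  · rw [abs_mul]; exact mul_le_mul (hB t).2 (hC t).2 (abs_nonneg _) hB0
  · simpa only [mul_assoc] using h'.mul _ _ (h.mul f g hfg)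

lemma pow {u v : ℝ → ℝ} (h : GaussMultiplier u v) (n : ℕ) :
    GaussMultiplier (fun t => u t ^ n) (fun t => v t ^ n) := by
  induction n with
  | zero => simpa using const (a := 1) (c := 1) (by simp)
  | succ n ih => simpa only [pow_succ] using ih.mul_mul h

lemma sum {ι : Type*} {u v : ι → ℝ → ℝ} (s : Finset ι) (h : ∀ i ∈ s, GaussMultiplier (u i) (v i)) :
    GaussMultiplier (fun t => ∑ i ∈ s, u i t) (fun t => ∑ i ∈ s, v i t) := by
  classical
  induction s using Finset.induction_on with
  | empty => simpa using const (a := 0) (c := 0) (by simp)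
  | insert i s hi ih =>
    simp only [Finset.sum_insert hi]
    exact (h i (Finset.mem_insert_self i s)).add
      (ih fun j hj => h j (Finset.mem_insert_of_mem hj))

lemma prod {ι : Type*} {u v : ι → ℝ → ℝ} (s : Finset ι)
    (h : ∀ i ∈ s, GaussMultiplier (u i) (v i)) :
    GaussMultiplier (fun t => ∏ i ∈ s, u i t) (fun t => ∏ i ∈ s, v i t) := by
  classical
  induction s using Finset.induction_on with
  | empty => simpa using const (a := 1) (c := 1) (by simp)
  | insert i s hi ih =>
    simp only [Finset.prod_insert hi]
    exact (h i (Finset.mem_insert_self i s)).mul_mul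
      (ih fun j hj => h j (Finset.mem_insert_of_mem hj))

lemma of_tendsto {U V : ℕ → ℝ → ℝ} {u v : ℝ → ℝ} (h : ∀ n, GaussMultiplier (U n) (V n)) {B : ℝ}
    (hB : ∀ n t, |U n t| ≤ B ∧ |V n t| ≤ B)
    (hu : ∀ t, Tendsto (fun n => U n t) atTop (nhds (u t)))
    (hv : ∀ t, Tendsto (fun n => V n t) atTop (nhds (v t))) : GaussMultiplier u v := by
  refine ⟨measurable_of_tendsto_metrizable (fun n => (h n).measurable_left)
      (tendsto_pi_nhds.2 hu), measurable_of_tendsto_metrizable (fun n => (h n).measurable_right)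
      (tendsto_pi_nhds.2 hv), ⟨B, fun t => ⟨?_, ?_⟩⟩, fun f g hfg => ?_⟩
  · exact le_of_tendsto (hu t).abs (Eventually.of_forall fun n => (hB n t).1)
  · exact le_of_tendsto (hv t).abs (Eventually.of_forall fun n => (hB n t).2)
  · obtain ⟨C, hC⟩ := hfg.bounded
    have hC0 : 0 ≤ C := (abs_nonneg _).trans (hC 0).1
    refine GaussMajorized.of_tendsto (B := C * B) (fun n => (h n).mul f g hfg)
      (fun n t => ⟨?_, ?_⟩) (fun t => (hu t).const_mul _) (fun t => (hv t).const_mul _)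
    · rw [abs_mul]; exact mul_le_mul (hC t).1 (hB n t).1 (abs_nonneg _) hC0
    · rw [abs_mul]; exact mul_le_mul (hC t).2 (hB n t).2 (abs_nonneg _) hC0

/-- The exponential series has nonnegative coefficients, and its partial sums are uniformly bounded
by `exp B`. -/
lemma exp {u v : ℝ → ℝ} (h : GaussMultiplier u v) :
    GaussMultiplier (fun t => Real.exp (u t)) (fun t => Real.exp (v t)) := by
  obtain ⟨B, hB⟩ := h.bounded
  have hB0 : 0 ≤ B := (abs_nonneg _).trans (hB 0).1
  have hterm : ∀ n : ℕ, GaussMultiplier (fun t => u t ^ n / (n.factorial : ℝ))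
      (fun t => v t ^ n / (n.factorial : ℝ)) := by
    intro n
    simp only [div_eq_mul_inv]
    exact (h.pow n).mul_mul (const (abs_of_nonneg (by positivity)).le)
  have hb : ∀ {x : ℝ} (n : ℕ), |x| ≤ B →
      |∑ i ∈ Finset.range n, x ^ i / (i.factorial : ℝ)| ≤ Real.exp B := by
    intro x n hx
    refine (Finset.abs_sum_le_sum_abs _ _).trans (le_trans ?_ (Real.sum_le_exp_of_nonneg hB0 n))
    refine Finset.sum_le_sum fun i _ => ?_
    rw [abs_div, abs_pow, abs_of_pos (show (0 : ℝ) < i.factorial by positivity)]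
    gcongr
  have hlim : ∀ x : ℝ, Tendsto (fun n : ℕ => ∑ i ∈ Finset.range n, x ^ i / (i.factorial : ℝ)) atTop
      (nhds (Real.exp x)) := by
    intro x
    have := (NormedSpace.expSeries_div_hasSum_exp (𝔸 := ℝ) x).tendsto_sum_nat
    rwa [← Real.exp_eq_exp_ℝ] at this
  exact of_tendsto (fun n => sum (Finset.range n) fun i _ => hterm i)
    (fun n t => ⟨hb n (hB t).1, hb n (hB t).2⟩) (fun t => hlim (u t)) (fun t => hlim (v t))

/-- The expansion is `∑ r ^ k / k * cos (k ν t)`, with nonnegative coefficients. The sign `ε` sits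
on the left only and disappears in absolute values, which lets `|ζ|⁻¹` share the majorant of `|ζ|`.
-/
lemma log_factor {r ε : ℝ} (hr : 0 ≤ r) (hr1 : r < 1) (hε : |ε| = 1) (ν : ℝ) :
    GaussMultiplier (fun t => ε * -Real.log ‖1 - r * Complex.exp (-(ν * t * Complex.I))‖)
      (fun t => -Real.log ‖1 - r * Complex.exp (-(ν * t * Complex.I))‖) := by
  have hnorm : ∀ t : ℝ, ‖(r : ℂ) * Complex.exp (-(ν * t * Complex.I))‖ = r := by
    intro t
    rw [norm_mul, Complex.norm_exp, Complex.norm_real, Real.norm_of_nonneg hr]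
    simp
  have hre : ∀ (t : ℝ) (k : ℕ), (((r : ℂ) * Complex.exp (-(ν * t * Complex.I))) ^ k / k).re =
      r ^ k / k * Real.cos (k * ν * t) := by
    intro t k
    rw [mul_pow, ← Complex.exp_nat_mul, ← Complex.ofReal_pow]
    have : ((k : ℂ) * -(ν * t * Complex.I)) = ((-(k * ν * t) : ℝ) : ℂ) * Complex.I := by
      push_cast; ring
    rw [this, mul_div_assoc, Complex.re_ofReal_mul, Complex.div_natCast_re,
      Complex.exp_ofReal_mul_I_re, Real.cos_neg]
    ring
  have hlim : ∀ t : ℝ, Tendsto (fun n : ℕ => ∑ k ∈ Finset.range n,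
      r ^ k / k * Real.cos (k * ν * t)) atTop
      (nhds (-Real.log ‖1 - r * Complex.exp (-(ν * t * Complex.I))‖)) := by
    intro t
    have h := (Complex.hasSum_re (Complex.hasSum_taylorSeries_neg_log
      (z := r * Complex.exp (-(ν * t * Complex.I))) (by rw [hnorm]; exact hr1))).tendsto_sum_nat
    simp only [hre, Complex.neg_re, Complex.log_re] at h
    exact h
  have hb : ∀ (n : ℕ) (t : ℝ), |∑ k ∈ Finset.range n, r ^ k / k * Real.cos (k * ν * t)| ≤
      (1 - r)⁻¹ := by
    intro n t
    refine (Finset.abs_sum_le_sum_abs _ _).trans ?_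
    rw [← tsum_geometric_of_lt_one hr hr1]
    refine le_trans (Finset.sum_le_sum fun k _ => ?_)
      ((summable_geometric_of_lt_one hr hr1).sum_le_tsum _ fun k _ => by positivity)
    rw [abs_mul, abs_of_nonneg (by positivity)]
    refine (mul_le_of_le_one_right (by positivity) (Real.abs_cos_le_one _)).trans ?_
    -- The term `k = 0` is `1 / 0 = 0`.
    rcases Nat.eq_zero_or_pos k with rfl | hk
    · simp
    · exact div_le_self (by positivity) (by exact_mod_cast hk)
  refine of_tendsto (B := (1 - r)⁻¹)
    (U := fun n t => ε * ∑ k ∈ Finset.range n, r ^ k / k * Real.cos (k * ν * t))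
    (V := fun n t => ∑ k ∈ Finset.range n, r ^ k / k * Real.cos (k * ν * t))
    (fun n => ?_) (fun n t => ⟨?_, hb n t⟩) (fun t => (hlim t).const_mul ε) hlim
  · simp only [Finset.mul_sum, ← mul_assoc]
    refine sum _ fun k _ => ?_
    refine cos ?_ _
    rw [abs_mul, hε, one_mul, abs_of_nonneg (by positivity)]
  · rw [abs_mul, hε, one_mul]
    exact hb n t

lemma norm_factor_pos {r : ℝ} (hr : 0 ≤ r) (hr1 : r < 1) (ν t : ℝ) :
    0 < ‖1 - r * Complex.exp (-(ν * t * Complex.I))‖ := by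
  have : ‖(r : ℂ) * Complex.exp (-(ν * t * Complex.I))‖ = r := by
    rw [norm_mul, Complex.norm_exp, Complex.norm_real, Real.norm_of_nonneg hr]
    simp
  have h := norm_sub_norm_le (1 : ℂ) (r * Complex.exp (-(ν * t * Complex.I)))
  rw [norm_one, this] at h
  linarith

lemma inv_factor {r : ℝ} (hr : 0 ≤ r) (hr1 : r < 1) (ν : ℝ) :
    GaussMultiplier (fun t => ‖1 - r * Complex.exp (-(ν * t * Complex.I))‖⁻¹)
      (fun t => ‖1 - r * Complex.exp (-(ν * t * Complex.I))‖⁻¹) := by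
  have h := (log_factor hr hr1 (ε := 1) (by simp) ν).exp
  simpa only [one_mul, Real.exp_neg, Real.exp_log (norm_factor_pos hr hr1 ν _)] using h

lemma factor {r : ℝ} (hr : 0 ≤ r) (hr1 : r < 1) (ν : ℝ) :
    GaussMultiplier (fun t => ‖1 - r * Complex.exp (-(ν * t * Complex.I))‖)
      (fun t => ‖1 - r * Complex.exp (-(ν * t * Complex.I))‖⁻¹) := by
  have h := (log_factor hr hr1 (ε := -1) (by simp) ν).exp
  simpa only [neg_mul_neg, one_mul, Real.exp_neg, Real.exp_log (norm_factor_pos hr hr1 ν _)] using h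

end GaussMultiplier

/-! ### The Euler product as a limit of multipliers -/

lemma natCast_cpow_neg_vertical {p : ℕ} (hp : p ≠ 0) (σ t : ℝ) :
    (p : ℂ) ^ (-((σ : ℂ) + Complex.I * t)) =
      ((p : ℝ) ^ (-σ) : ℝ) * Complex.exp (-(Real.log p * t * Complex.I)) := by
  have hp' : (p : ℂ) ≠ 0 := by exact_mod_cast hp
  have hp0 : 0 < (p : ℝ) := by exact_mod_cast Nat.pos_of_ne_zero hp
  rw [Complex.cpow_def_of_ne_zero hp', Real.rpow_def_of_pos hp0, Complex.ofReal_exp,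
    ← Complex.exp_add, ← Complex.natCast_log]
  congr 1
  push_cast
  ring

lemma natCast_rpow_neg_lt_one {p : ℕ} (hp : p.Prime) {σ : ℝ} (hσ : 1 < σ) :
    (p : ℝ) ^ (-σ) < 1 :=
  Real.rpow_lt_one_of_one_lt_of_neg (by exact_mod_cast hp.one_lt) (by linarith)

lemma tendsto_prod_norm_riemannZeta {σ : ℝ} (hσ : 1 < σ) (t : ℝ) :
    Tendsto (fun n : ℕ => ∏ p ∈ n.primesBelow,
      ‖1 - ((p : ℝ) ^ (-σ) : ℝ) * Complex.exp (-(Real.log p * t * Complex.I))‖⁻¹) atTop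
      (nhds ‖riemannZeta (σ + Complex.I * t)‖) := by
  refine (riemannZeta_eulerProduct (s := σ + Complex.I * t) (by simpa using hσ)).norm.congr
    fun n => ?_
  rw [norm_prod]
  refine Finset.prod_congr rfl fun p hp => ?_
  rw [norm_inv, natCast_cpow_neg_vertical (Nat.prime_of_mem_primesBelow hp).ne_zero]

/-- At `t = 0` the partial products converge, hence are bounded. They dominate the partial products
for `ζ` and `1 / ζ` at every `t`, as passing to the limit requires. -/
lemma exists_prod_euler_factor_le {σ : ℝ} (hσ : 1 < σ) :
    ∃ B : ℝ, ∀ n : ℕ, ∏ p ∈ n.primesBelow, (1 - (p : ℝ) ^ (-σ))⁻¹ ≤ B := by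
  obtain ⟨B, hB⟩ := (tendsto_prod_norm_riemannZeta hσ 0).bddAbove_range
  refine ⟨B, fun n => le_of_eq_of_le (Finset.prod_congr rfl fun p hp => ?_) (hB ⟨n, rfl⟩)⟩
  have := natCast_rpow_neg_lt_one (Nat.prime_of_mem_primesBelow hp) hσ
  rw [Complex.ofReal_zero, mul_zero, zero_mul, neg_zero, Complex.exp_zero, mul_one,
    ← Complex.ofReal_one, ← Complex.ofReal_sub, Complex.norm_real,
    Real.norm_of_nonneg (by linarith)]

lemma norm_euler_factor_le {r : ℝ} (hr : 0 ≤ r) (hr1 : r < 1) (ν t : ℝ) :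
    ‖1 - r * Complex.exp (-(ν * t * Complex.I))‖⁻¹ ≤ (1 - r)⁻¹ ∧
    ‖1 - r * Complex.exp (-(ν * t * Complex.I))‖ ≤ (1 - r)⁻¹ := by
  have hn : ‖(r : ℂ) * Complex.exp (-(ν * t * Complex.I))‖ = r := by
    rw [norm_mul, Complex.norm_exp, Complex.norm_real, Real.norm_of_nonneg hr]
    simp
  have h1 := norm_sub_norm_le (1 : ℂ) (r * Complex.exp (-(ν * t * Complex.I)))
  have h2 := norm_sub_le (1 : ℂ) (r * Complex.exp (-(ν * t * Complex.I)))
  rw [norm_one, hn] at h1 h2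
  have hr' : 0 < 1 - r := by linarith
  refine ⟨inv_anti₀ hr' h1, h2.trans ?_⟩
  rw [← one_div, le_div_iff₀ hr']
  nlinarith

/-- The majorant principle for `|ζ|` on a vertical line in the region of absolute convergence. -/
theorem gaussMajorized_norm_riemannZeta {σ : ℝ} (hσ : 1 < σ) :
    GaussMajorized (fun t => ‖riemannZeta (σ + Complex.I * t)‖)
      (fun t => ‖riemannZeta (σ + Complex.I * t)‖) ∧
    GaussMajorized (fun t => ‖riemannZeta (σ + Complex.I * t)‖⁻¹)
      (fun t => ‖riemannZeta (σ + Complex.I * t)‖) := by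
  obtain ⟨B, hB⟩ := exists_prod_euler_factor_le hσ
  have hr0 : ∀ p : ℕ, 0 ≤ (p : ℝ) ^ (-σ) := fun p => by positivity
  have hr1 : ∀ {n p : ℕ}, p ∈ n.primesBelow → (p : ℝ) ^ (-σ) < 1 := fun hp =>
    natCast_rpow_neg_lt_one (Nat.prime_of_mem_primesBelow hp) hσ
  have hb1 : ∀ (n : ℕ) (t : ℝ), |∏ p ∈ n.primesBelow,
      ‖1 - ((p : ℝ) ^ (-σ) : ℝ) * Complex.exp (-(Real.log p * t * Complex.I))‖⁻¹| ≤ B := by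
    intro n t
    rw [abs_of_nonneg (Finset.prod_nonneg fun p _ => by positivity)]
    exact (Finset.prod_le_prod (fun p _ => by positivity) fun p hp =>
      (norm_euler_factor_le (hr0 p) (hr1 hp) _ t).1).trans (hB n)
  have hb2 : ∀ (n : ℕ) (t : ℝ), |∏ p ∈ n.primesBelow,
      ‖1 - ((p : ℝ) ^ (-σ) : ℝ) * Complex.exp (-(Real.log p * t * Complex.I))‖| ≤ B := by
    intro n t
    rw [abs_of_nonneg (Finset.prod_nonneg fun p _ => by positivity)]
    exact (Finset.prod_le_prod (fun p _ => by positivity) fun p hp =>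
      (norm_euler_factor_le (hr0 p) (hr1 hp) _ t).2).trans (hB n)
  have hlim := tendsto_prod_norm_riemannZeta hσ
  have hlim' : ∀ t : ℝ, Tendsto (fun n : ℕ => ∏ p ∈ n.primesBelow,
      ‖1 - ((p : ℝ) ^ (-σ) : ℝ) * Complex.exp (-(Real.log p * t * Complex.I))‖) atTop
      (nhds ‖riemannZeta (σ + Complex.I * t)‖⁻¹) := by
    intro t
    have h0 : ‖riemannZeta (σ + Complex.I * t)‖ ≠ 0 :=
      norm_ne_zero_iff.2 (riemannZeta_ne_zero_of_one_le_re (by simpa using hσ.le))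
    refine ((hlim t).inv₀ h0).congr fun n => ?_
    rw [Finset.prod_inv_distrib, inv_inv]
  have m1 := GaussMultiplier.of_tendsto (B := B)
    (fun n => GaussMultiplier.prod n.primesBelow fun p hp =>
      GaussMultiplier.inv_factor (hr0 p) (hr1 hp) (Real.log p))
    (fun n t => ⟨hb1 n t, hb1 n t⟩) hlim hlim
  have m2 := GaussMultiplier.of_tendsto (B := B)
    (fun n => GaussMultiplier.prod n.primesBelow fun p hp =>
      GaussMultiplier.factor (hr0 p) (hr1 hp) (Real.log p))
    (fun n t => ⟨hb2 n t, hb1 n t⟩) hlim' hlim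
  exact ⟨by simpa using m1.mul _ _ GaussMajorized.one, by simpa using m2.mul _ _ GaussMajorized.one⟩

/-! ### The Gaussian mean across the pole -/

lemma integral_indicator_inv_add_abs {η : ℝ} (hη : 0 < η) :
    MeasureTheory.Integrable
      ((Set.Icc (-1 : ℝ) 1).indicator fun t : ℝ => 2 * (η + |t|)⁻¹) ∧
    ∫ t : ℝ, (Set.Icc (-1 : ℝ) 1).indicator (fun t : ℝ => 2 * (η + |t|)⁻¹) t =
      4 * Real.log ((η + 1) / η) := by
  have hne : ∀ t : ℝ, η + |t| ≠ 0 := fun t => by positivity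
  have hc : Continuous fun t : ℝ => 2 * (η + |t|)⁻¹ :=
    continuous_const.mul ((continuous_const.add continuous_abs).inv₀ hne)
  refine ⟨(MeasureTheory.integrable_indicator_iff measurableSet_Icc).2
    hc.continuousOn.integrableOn_Icc, ?_⟩
  rw [MeasureTheory.integral_indicator measurableSet_Icc, MeasureTheory.integral_Icc_eq_integral_Ioc,
    ← intervalIntegral.integral_of_le (by norm_num)]
  have h1 : ∫ t in (0 : ℝ)..1, 2 * (η + |t|)⁻¹ = 2 * Real.log ((η + 1) / η) := by
    have : ∫ t in (0 : ℝ)..1, 2 * (η + |t|)⁻¹ = ∫ t in (0 : ℝ)..1, 2 * (η + t)⁻¹ := by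
      refine intervalIntegral.integral_congr fun t ht => ?_
      rw [Set.uIcc_of_le zero_le_one] at ht
      simp only [abs_of_nonneg ht.1]
    rw [this, intervalIntegral.integral_const_mul,
      intervalIntegral.integral_comp_add_left (fun x => x⁻¹) η, add_zero,
      integral_inv_of_pos hη (by positivity)]
  have h2 : ∫ t in (-1 : ℝ)..0, 2 * (η + |t|)⁻¹ = ∫ t in (0 : ℝ)..1, 2 * (η + |t|)⁻¹ := by
    have := intervalIntegral.integral_comp_neg (a := 0) (b := 1) fun t : ℝ => 2 * (η + |t|)⁻¹
    simp only [abs_neg, neg_zero] at this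
    exact this.symm
  rw [← intervalIntegral.integral_add_adjacent_intervals (hc.intervalIntegrable (-1) 0)
    (hc.intervalIntegrable 0 1), h2, h1]
  ring

/-- The pole contributes the logarithm; the rest grows linearly and is integrable against the
Gaussian uniformly in `η`. -/
lemma exists_gauss_integral_norm_riemannZeta_le :
    ∃ D : ℝ, 0 < D ∧ ∀ η : ℝ, 0 < η → η ≤ 1 →
      ∫ t : ℝ, Real.exp (-t ^ 2) * ‖riemannZeta ((1 + η : ℝ) + Complex.I * t)‖ ≤
        D + 4 * Real.log (1 / η) := by
  obtain ⟨C, hC, hz⟩ := exists_norm_riemannZeta_le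
  have hint : MeasureTheory.Integrable fun t : ℝ => Real.exp (-t ^ 2) * (1 + C * (2 + |t|)) := by
    have i1 := integrable_const_mul_gauss (1 + C * 2)
    have i2 := ((integrable_mul_exp_neg_mul_sq (b := 1) one_pos).norm).const_mul C
    refine (i1.add i2).congr (Eventually.of_forall fun t => ?_)
    simp only [Pi.add_apply, norm_mul, Real.norm_eq_abs, Real.abs_exp]
    ring_nf
  refine ⟨4 * Real.log 2 + (∫ t : ℝ, Real.exp (-t ^ 2) * (1 + C * (2 + |t|))), ?_, ?_⟩
  · have h2 : 0 < Real.log 2 := Real.log_pos one_lt_two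
    have : 0 ≤ ∫ t : ℝ, Real.exp (-t ^ 2) * (1 + C * (2 + |t|)) :=
      MeasureTheory.integral_nonneg fun t => by positivity
    positivity
  intro η hη hη1
  obtain ⟨hi, hval⟩ := integral_indicator_inv_add_abs hη
  have hlog : 4 * Real.log ((η + 1) / η) ≤ 4 * Real.log 2 + 4 * Real.log (1 / η) := by
    rw [← mul_add, ← Real.log_mul (by norm_num) (by positivity)]
    gcongr
    rw [mul_one_div]
    gcongr
    linarith
  have hmono : ∫ t : ℝ, Real.exp (-t ^ 2) * ‖riemannZeta ((1 + η : ℝ) + Complex.I * t)‖ ≤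
      ∫ t : ℝ, ((Set.Icc (-1 : ℝ) 1).indicator (fun t : ℝ => 2 * (η + |t|)⁻¹) t +
        Real.exp (-t ^ 2) * (1 + C * (2 + |t|))) := by
    refine MeasureTheory.integral_mono_of_nonneg (Eventually.of_forall fun t => by positivity)
      (hi.add hint) (Eventually.of_forall fun t => ?_)
    set s : ℂ := (1 + η : ℝ) + Complex.I * t with hs
    have hre : s.re = 1 + η := by simp [hs]
    have hs1 : s ≠ 1 := by
      intro h
      rw [h] at hre
      simp at hre
      linarith
    have hsub : s - 1 = (η : ℂ) + Complex.I * t := by rw [hs]; push_cast; ring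
    have hη' : η ≤ ‖s - 1‖ := by
      refine le_trans (le_of_eq ?_) (Complex.re_le_norm _)
      simp [hsub]
    have ht' : |t| ≤ ‖s - 1‖ := by
      refine le_trans (le_of_eq ?_) (Complex.abs_im_le_norm _)
      simp [hsub]
    have hsn : ‖s‖ ≤ 2 + |t| := by
      refine (norm_add_le _ _).trans (add_le_add ?_ ?_)
      · rw [Complex.norm_real, Real.norm_of_nonneg (by linarith)]; linarith
      · rw [norm_mul, Complex.norm_I, one_mul, Complex.norm_real, Real.norm_eq_abs]
    have hexp : Real.exp (-t ^ 2) ≤ 1 := Real.exp_le_one_iff.2 (by nlinarith [sq_nonneg t])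
    have hpole : Real.exp (-t ^ 2) * (1 / ‖s - 1‖) ≤
        (Set.Icc (-1 : ℝ) 1).indicator (fun t : ℝ => 2 * (η + |t|)⁻¹) t + Real.exp (-t ^ 2) := by
      by_cases ht : t ∈ Set.Icc (-1 : ℝ) 1
      · rw [Set.indicator_of_mem ht]
        -- Both `η` and `|t|` are at most `‖s - 1‖`, so their sum is at most twice it.
        have : 1 / ‖s - 1‖ ≤ 2 * (η + |t|)⁻¹ := by
          rw [← div_eq_mul_inv, div_le_div_iff₀ (hη.trans_le hη') (by positivity)]
          linarith
        have h0 : Real.exp (-t ^ 2) * (1 / ‖s - 1‖) ≤ 1 / ‖s - 1‖ :=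
          mul_le_of_le_one_left (by positivity) hexp
        linarith [Real.exp_pos (-t ^ 2)]
      · rw [Set.indicator_of_notMem ht, zero_add]
        have h1 : 1 < |t| := by
          by_contra h
          exact ht (abs_le.1 (not_lt.1 h))
        refine mul_le_of_le_one_right (Real.exp_pos _).le ?_
        rw [div_le_one (by linarith)]
        linarith
    have hzb := hz s (by rw [hre]; linarith) hs1
    calc Real.exp (-t ^ 2) * ‖riemannZeta s‖
        ≤ Real.exp (-t ^ 2) * (1 / ‖s - 1‖ + C * (2 + |t|)) := by
          gcongr
          exact hzb.trans (by gcongr)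
      _ = Real.exp (-t ^ 2) * (1 / ‖s - 1‖) + Real.exp (-t ^ 2) * (C * (2 + |t|)) := by ring
      _ ≤ _ := by linarith [hpole]
  rw [MeasureTheory.integral_add hi hint, hval] at hmono
  linarith

/-! ### From Gaussian means to short intervals -/

/-- After shifting to `[0, δ]`, the weight `exp (δ² - t²)` is at least `1` there. -/
lemma intervalIntegral_le_gauss_integral {F f : ℝ → ℝ} {B K T δ : ℝ} (hδ : 0 ≤ δ) (hK : 0 ≤ K)
    (hf : Measurable f) (hf0 : ∀ t, 0 ≤ f t) (hfB : ∀ t, f t ≤ B) (hF0 : ∀ t, 0 ≤ F t)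
    (hF : ∀ t ∈ Set.Icc T (T + δ), F t ≤ K * f t) :
    ∫ t in T..(T + δ), F t ≤
      K * Real.exp (δ ^ 2) * ∫ t : ℝ, Real.exp (-t ^ 2) * f (t + T) := by
  have hint : MeasureTheory.Integrable fun t : ℝ => Real.exp (-t ^ 2) * f (t + T) := by
    refine (integrable_const_mul_gauss B).mono' ?_ (Eventually.of_forall fun t => ?_)
    · have : Measurable fun t : ℝ => f (t + T) := hf.comp (measurable_id.add_const T)
      exact Measurable.aestronglyMeasurable (by fun_prop)
    · rw [Real.norm_of_nonneg (mul_nonneg (Real.exp_pos _).le (hf0 _)), mul_comm]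
      gcongr
      exact hfB _
  have hshift : ∫ t in T..(T + δ), F t = ∫ t in (0 : ℝ)..δ, F (t + T) := by
    rw [intervalIntegral.integral_comp_add_right, zero_add, add_comm]
  rw [hshift, intervalIntegral.integral_of_le hδ, ← MeasureTheory.integral_const_mul]
  calc ∫ t in Set.Ioc 0 δ, F (t + T)
      ≤ ∫ t in Set.Ioc 0 δ, K * Real.exp (δ ^ 2) * (Real.exp (-t ^ 2) * f (t + T)) := by
        refine MeasureTheory.integral_mono_of_nonneg (Eventually.of_forall fun t => hF0 _)
          (hint.const_mul _).integrableOn ?_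
        refine (MeasureTheory.ae_restrict_iff' measurableSet_Ioc).2 (Eventually.of_forall
          fun t ht => ?_)
        have h1 := hF (t + T) ⟨by linarith [ht.1], by linarith [ht.2]⟩
        have h2 : 1 ≤ Real.exp (δ ^ 2) * Real.exp (-t ^ 2) := by
          rw [← Real.exp_add]
          exact Real.one_le_exp (by nlinarith [ht.1, ht.2])
        calc F (t + T) ≤ K * f (t + T) := h1
          _ = 1 * (K * f (t + T)) := (one_mul _).symm
          _ ≤ Real.exp (δ ^ 2) * Real.exp (-t ^ 2) * (K * f (t + T)) :=
            mul_le_mul_of_nonneg_right h2 (mul_nonneg hK (hf0 _))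
          _ = K * Real.exp (δ ^ 2) * (Real.exp (-t ^ 2) * f (t + T)) := by ring
    _ ≤ ∫ t, K * Real.exp (δ ^ 2) * (Real.exp (-t ^ 2) * f (t + T)) :=
        MeasureTheory.setIntegral_le_integral (hint.const_mul _) (Eventually.of_forall fun t =>
          mul_nonneg (by positivity) (mul_nonneg (Real.exp_pos _).le (hf0 _)))

/-- If `F` is bounded on `[T, T + δ]` by a multiple of a function majorized by `|ζ|` on the line
`re s = 1 + 1 / log log T`, then its integral is `O(log log log T)`. -/
lemma isBigO_integral_of_majorized {δ K : ℝ} (hδ : 0 ≤ δ) (hK : 0 ≤ K) {F : ℝ → ℝ}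
    {f : ℝ → ℝ → ℝ} (hF0 : ∀ t, 0 ≤ F t) (hf0 : ∀ σ t, 0 ≤ f σ t)
    (hf : ∀ σ : ℝ, 1 < σ →
      GaussMajorized (f σ) (fun t => ‖riemannZeta (σ + Complex.I * t)‖))
    (hF : ∀ᶠ T : ℝ in atTop, ∀ t ∈ Set.Icc T (2 * T),
      F t ≤ K * f (1 + 1 / Real.log (Real.log T)) t) :
    (fun T : ℝ => ∫ t in T..(T + δ), F t) =O[atTop]
      (fun T : ℝ => Real.log (Real.log (Real.log T))) := by
  obtain ⟨D, hD, hbd⟩ := exists_gauss_integral_norm_riemannZeta_le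
  have hll : Tendsto (fun T => Real.log (Real.log T)) atTop atTop :=
    Real.tendsto_log_atTop.comp Real.tendsto_log_atTop
  have hlll : Tendsto (fun T => Real.log (Real.log (Real.log T))) atTop atTop :=
    Real.tendsto_log_atTop.comp hll
  refine IsBigO.of_bound (K * Real.exp (δ ^ 2) * (D + 4)) ?_
  -- Taking `T ≥ δ` puts `[T, T + δ]` inside `[T, 2 T]`; `log l ≥ 1` later absorbs the constant `D`.
  filter_upwards [hF, hll.eventually_ge_atTop 1, hlll.eventually_ge_atTop 1,
    eventually_ge_atTop δ] with T hFT hl1 hL hTδ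
  set l := Real.log (Real.log T)
  have hl0 : 0 < l := by linarith
  have hη0 : 0 < 1 / l := by positivity
  have hη1 : 1 / l ≤ 1 := by rw [div_le_one hl0]; exact hl1
  have hmaj := hf (1 + 1 / l) (by linarith)
  obtain ⟨B, hB⟩ := hmaj.bounded
  rw [Real.norm_of_nonneg (intervalIntegral.integral_nonneg (by linarith) fun t _ => hF0 t),
    Real.norm_of_nonneg (by linarith)]
  have hint := intervalIntegral_le_gauss_integral (T := T) hδ hK hmaj.measurable_left (hf0 _)
    (fun t => (le_abs_self _).trans (hB t).1) hF0
    (fun t ht => hFT t ⟨ht.1, by linarith [ht.2]⟩)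
  have hb := hbd (1 / l) hη0 hη1
  rw [one_div_one_div] at hb
  calc ∫ t in T..(T + δ), F t ≤ _ := hint
    _ ≤ K * Real.exp (δ ^ 2) * (D + 4 * Real.log l) := by
      gcongr
      exact (hmaj.integral_le T).trans hb
    _ ≤ K * Real.exp (δ ^ 2) * ((D + 4) * Real.log l) := by
      gcongr
      nlinarith
    _ = _ := by ring

theorem theorem4 (hRH : RiemannHypothesis) (δ : ℝ) (hδ : 0 < δ) :
    ((fun T : ℝ => ∫ t in T..(T + δ), ‖riemannZeta (1 + Complex.I * (t : ℂ))‖)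
        =O[atTop] (fun T : ℝ => Real.log (Real.log (Real.log T)))) ∧
    ((fun T : ℝ => ∫ t in T..(T + δ), ‖riemannZeta (1 + Complex.I * (t : ℂ))‖⁻¹)
        =O[atTop] (fun T : ℝ => Real.log (Real.log (Real.log T)))) := by
  obtain ⟨K, hK, hcomp⟩ := hRH.exists_norm_riemannZeta_comparison
  constructor
  · exact isBigO_integral_of_majorized (f := fun σ t => ‖riemannZeta (σ + Complex.I * t)‖)
      hδ.le hK.le (fun t => norm_nonneg _) (fun σ t => norm_nonneg _)
      (fun σ hσ => (gaussMajorized_norm_riemannZeta hσ).1)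
      (hcomp.mono fun T hT t ht => (hT t ht).1)
  · exact isBigO_integral_of_majorized (f := fun σ t => ‖riemannZeta (σ + Complex.I * t)‖⁻¹)
      hδ.le hK.le (fun t => inv_nonneg.2 (norm_nonneg _)) (fun σ t => inv_nonneg.2 (norm_nonneg _))
      (fun σ hσ => (gaussMajorized_norm_riemannZeta hσ).2)
      (hcomp.mono fun T hT t ht => (hT t ht).2)
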